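/- Let $G$ be a finite simple graph that is bipartite and outerplanar, i.e. $G$ has a planar drawing (vertices drawn as distinct points of the plane, edges as simple Jordan arcs meeting only in common ends and passing through no other vertex) in which every vertex lies on the boundary of the outer (unbounded) face. Then $G$ has a planar straight-line drawing in which every edge has length $1$. Consequently, if $G$ has at least one edge, its planar edge-length ratio, i.e. the minimum, over all planar straight-line drawings of $G$, of the ratio between the length of a longest edge and the length of a shortest edge, equals $1$. -/

import Mathlib

namespace GraphDrawing

/-- The Euclidean plane. -/
abbrev Plane : Type := EuclideanSpace ℝ (Fin 2)

/-- `pos` (positions of the vertices) and `arc` (curves of the edges) form a planar drawing of `G`: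
distinct vertices are distinct points, every edge is a simple (Jordan) arc joining its two
endvertices, an edge passes through no vertex other than its ends, and two distinct edges meet only
in common ends. The values of `arc` outside the edge set of `G` are irrelevant. -/
structure IsPlanarDrawing {V : Type*} (G : SimpleGraph V) (pos : V → Plane)
    (arc : Sym2 V → Set Plane) : Prop where
  pos_injective : Function.Injective pos
  isArc : ∀ u v : V, G.Adj u v →
    ∃ γ : Path (pos u) (pos v), Function.Injective γ ∧ Set.range γ = arc s(u, v)
  vertex_mem : ∀ e ∈ G.edgeSet, ∀ w : V, pos w ∈ arc e → w ∈ e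
  inter_subset : ∀ e ∈ G.edgeSet, ∀ f ∈ G.edgeSet, e ≠ f →
    arc e ∩ arc f ⊆ pos '' {w | w ∈ e ∧ w ∈ f}

/-- The set of points of the plane covered by a drawing. -/
def carrier {V : Type*} (G : SimpleGraph V) (pos : V → Plane) (arc : Sym2 V → Set Plane) :
    Set Plane :=
  Set.range pos ∪ ⋃ e ∈ G.edgeSet, arc e

/-- The outer face of a drawing covering the set `S`: the unbounded connected component of the
complement of `S` (there is exactly one when `S` is compact). -/
def outerFace (S : Set Plane) : Set Plane :=
  {x | x ∈ Sᶜ ∧ ¬ Bornology.IsBounded (connectedComponentIn Sᶜ x)}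

/-- A graph is outerplanar if it has a planar drawing (with edges drawn as Jordan arcs) in which
every vertex lies on the boundary of the outer face. -/
def IsOuterplanar {V : Type*} (G : SimpleGraph V) : Prop :=
  ∃ (pos : V → Plane) (arc : Sym2 V → Set Plane), IsPlanarDrawing G pos arc ∧
    ∀ v : V, pos v ∈ frontier (outerFace (carrier G pos arc))

/-- The straight-line segment between the two ends of an edge. -/
def edgeSegment {V : Type*} (pos : V → Plane) : Sym2 V → Set Plane :=
  Sym2.lift ⟨fun u v => segment ℝ (pos u) (pos v), fun u v => segment_symm ℝ (pos u) (pos v)⟩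

/-- A planar straight-line drawing: a planar drawing whose edges are straight-line segments. -/
def IsPlanarStraightLineDrawing {V : Type*} (G : SimpleGraph V) (pos : V → Plane) : Prop :=
  IsPlanarDrawing G pos (edgeSegment pos)

/-- The set of lengths of the edges in the straight-line drawing given by `pos`. -/
def edgeLengths {V : Type*} (G : SimpleGraph V) (pos : V → Plane) : Set ℝ :=
  {l | ∃ u v : V, G.Adj u v ∧ l = dist (pos u) (pos v)}

/-- The set of all ratios (longest edge length) / (shortest edge length), over all planar
straight-line drawings of `G`. -/
def edgeLengthRatios {V : Type*} (G : SimpleGraph V) : Set ℝ :=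
  {r | ∃ pos : V → Plane, IsPlanarStraightLineDrawing G pos ∧
    ∃ longest shortest : ℝ, IsGreatest (edgeLengths G pos) longest ∧
      IsLeast (edgeLengths G pos) shortest ∧ r = longest / shortest}

/-- `r` is the planar edge-length ratio of `G`: the smallest ratio between the longest and the
shortest edge length over all planar straight-line drawings of `G` (the minimum is attained). -/
def IsPlanarEdgeLengthRatio {V : Type*} (G : SimpleGraph V) (r : ℝ) : Prop :=
  IsLeast (edgeLengthRatios G) r

end GraphDrawing

/-! ### Continuous logarithms and winding of paths around points -/

namespace GraphDrawing

/-! Outerplanarity enters only through two forbidden minors; the unit drawing is then built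
combinatorially out of rhombi.

Obstruction: join a point of the outer face to every branch set of a `K₄` or `K₂,₃` model. This
gives curves for `K₅` or `K₃,₃` in which independent edges are disjoint, while curves of adjacent
edges may meet freely. A parity count excludes this without the Jordan curve theorem. For disjoint
paths `e`, `g` the map `(s, t) ↦ g t - e s` has a continuous logarithm on the square, whose total
change around the boundary is zero; this is the integer identity `turns_square`. Added over all
pairs of independent edges, these identities fail modulo 2.

Order: without a `K₄` minor, some vertex has degree one or two unless there are no edges
(`exists_degree_le_two`). Deleting or suppressing it and putting it back gives, by induction, a
linear order without crossing half circles (`exists_noncrossing`); if both sides of the suppressed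
edge are blocked, a `K₂,₃` minor appears. The bipartition refines the order to natural numbers of
opposite parity at adjacent vertices.

Drawing: an interval of odd length greater than one splits along a quadrilateral into three
intervals of odd length (`exists_quadrilateral`). The quadrilateral is drawn as a rhombus on the
given unit segment. Its three new sides own sectors that lie inside the old sector and meet only in
common ends (`sector_split`), so the recursive drawings never collide. -/

open Complex in
/-- A nowhere vanishing continuous function has a continuous logarithm on the closed unit ball. -/
lemma exists_continuousOn_log {E : Type*} [NormedAddCommGroup E] [NormedSpace ℝ E] [ProperSpace E]
    (f : E → ℂ) (hf : Continuous f) (h0 : ∀ x, f x ≠ 0) :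
    ∃ g : E → ℂ, ContinuousOn g (Metric.closedBall 0 1) ∧
      ∀ x ∈ Metric.closedBall (0 : E) 1, exp (g x) = f x := by
  have hK : IsCompact (Metric.closedBall (0 : E) 1) := isCompact_closedBall 0 1
  obtain ⟨z, hz, hmin⟩ := hK.exists_isMinOn ⟨0, by simp⟩ hf.norm.continuousOn
  have hc : 0 < ‖f z‖ := norm_pos_iff.mpr (h0 z)
  have huc := hK.uniformContinuousOn_of_continuous hf.continuousOn
  rw [Metric.uniformContinuousOn_iff] at huc
  obtain ⟨δ, hδ, hfδ⟩ := huc _ hc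
  obtain ⟨n, hn⟩ := exists_nat_one_div_lt hδ
  set N : ℕ := n + 1 with hN
  have hNpos : (0 : ℝ) < N := by positivity
  have hball : ∀ x ∈ Metric.closedBall (0 : E) 1, ∀ k : ℕ, k ≤ N →
      ((k : ℝ) / N) • x ∈ Metric.closedBall (0 : E) 1 := by
    intro x hx k hk
    rw [mem_closedBall_zero_iff] at hx ⊢
    rw [norm_smul, Real.norm_of_nonneg (by positivity)]
    have : (k : ℝ) / N ≤ 1 := by rw [div_le_one hNpos]; exact_mod_cast hk
    calc _ ≤ 1 * ‖x‖ := by gcongr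
      _ ≤ 1 := by simpa using hx
  -- Successive points on a ray are closer than `δ`, so the values of `f` differ by less than its
  -- minimum modulus. The quotient is thus within distance 1 of 1, where the principal logarithm is
  -- continuous.
  have hslit : ∀ x ∈ Metric.closedBall (0 : E) 1, ∀ k ∈ Finset.range N,
      f (((k + 1 : ℕ) / N : ℝ) • x) / f ((k / N : ℝ) • x) ∈ slitPlane := by
    intro x hx k hk
    rw [Finset.mem_range] at hk
    have h1 := hball x hx (k + 1) (by omega)
    have h2 := hball x hx k (by omega)
    have hd : dist (((k + 1 : ℕ) / N : ℝ) • x) ((k / N : ℝ) • x) < δ := by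
      rw [dist_eq_norm, ← sub_smul, norm_smul]
      have : ((k + 1 : ℕ) / N - k / N : ℝ) = 1 / N := by push_cast; ring
      rw [this, Real.norm_of_nonneg (by positivity)]
      rw [mem_closedBall_zero_iff] at hx
      calc _ ≤ 1 / (N : ℝ) * 1 := by gcongr
        _ < δ := by rw [hN]; push_cast; simpa using hn
    have h3 := hfδ _ h1 _ h2 hd
    rw [dist_eq_norm] at h3
    have h4 : ‖f z‖ ≤ ‖f ((k / N : ℝ) • x)‖ := hmin h2
    have h5 : f (((k + 1 : ℕ) / N : ℝ) • x) / f ((k / N : ℝ) • x) ∈ Metric.ball (1 : ℂ) 1 := by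
      rw [mem_ball_iff_norm, div_sub_one (h0 _), norm_div,
        div_lt_one (norm_pos_iff.mpr (h0 _))]
      exact h3.trans_le h4
    exact ball_one_subset_slitPlane h5
  -- The quotients along the ray from 0 to `x` telescope to `f x / f 0`.
  refine ⟨fun x => log (f 0) + ∑ k ∈ Finset.range N,
    log (f (((k + 1 : ℕ) / N : ℝ) • x) / f ((k / N : ℝ) • x)), ?_, ?_⟩
  · refine continuousOn_const.add (continuousOn_finsetSum _ fun k hk => ?_)
    refine ContinuousOn.clog ?_ fun x hx => hslit x hx k hk
    exact ContinuousOn.div (by fun_prop) (by fun_prop) fun x _ => h0 _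
  · intro x hx
    rw [exp_add, exp_log (h0 0), exp_sum]
    have : ∀ m : ℕ, f 0 * ∏ k ∈ Finset.range m,
        exp (log (f (((k + 1 : ℕ) / N : ℝ) • x) / f ((k / N : ℝ) • x))) =
        f ((m / N : ℝ) • x) := by
      intro m
      induction m with
      | zero => simp
      | succ m ih =>
        rw [Finset.prod_range_succ, ← mul_assoc, ih,
          exp_log (div_ne_zero (h0 _) (h0 _)), mul_div_cancel₀ _ (h0 _)]
    rw [this N, div_self hNpos.ne', one_smul]

/-- Two continuous logarithms of a path differ by a constant. -/
lemma log_lift_sub_eq {γ ℓ ℓ' : ℝ → ℂ} (h : ContinuousOn ℓ (Set.Icc 0 1))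
    (h' : ContinuousOn ℓ' (Set.Icc 0 1)) (he : ∀ t ∈ Set.Icc (0 : ℝ) 1, Complex.exp (ℓ t) = γ t)
    (he' : ∀ t ∈ Set.Icc (0 : ℝ) 1, Complex.exp (ℓ' t) = γ t) :
    ℓ 1 - ℓ 0 = ℓ' 1 - ℓ' 0 := by
  have hint : ∀ t ∈ Set.Icc (0 : ℝ) 1, ∃ n : ℤ, ℓ t = ℓ' t + n * (2 * Real.pi * Complex.I) :=
    fun t ht => Complex.exp_eq_exp_iff_exists_int.mp ((he t ht).trans (he' t ht).symm)
  have hpi := Real.pi_pos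
  set φ : ℝ → ℝ := fun t => (ℓ t - ℓ' t).im / (2 * Real.pi) with hφ
  have hφc : ContinuousOn φ (Set.Icc 0 1) :=
    (Complex.continuous_im.comp_continuousOn (h.sub h')).div_const _
  have hφn : ∀ t ∈ Set.Icc (0 : ℝ) 1, ∀ n : ℤ, ℓ t = ℓ' t + n * (2 * Real.pi * Complex.I) →
      φ t = n := by
    intro t ht n hn
    simp only [hφ, hn]
    have : (ℓ' t + n * (2 * Real.pi * Complex.I) - ℓ' t).im = n * (2 * Real.pi) := by
      simp
    rw [this]
    field_simp
  have h0 : (0 : ℝ) ∈ Set.Icc (0 : ℝ) 1 := by simp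
  have h1 : (1 : ℝ) ∈ Set.Icc (0 : ℝ) 1 := by simp
  obtain ⟨n0, hn0⟩ := hint 0 h0
  obtain ⟨n1, hn1⟩ := hint 1 h1
  have hoc : (φ '' Set.Icc 0 1).OrdConnected :=
    (isPreconnected_Icc.image φ hφc).ordConnected
  -- `φ` is continuous and integer-valued, so it cannot take the intermediate value `a + 1/2`.
  have key : ∀ a b : ℤ, (a : ℝ) ∈ φ '' Set.Icc 0 1 → (b : ℝ) ∈ φ '' Set.Icc 0 1 → ¬ a < b := by
    intro a b ha hb hab
    have hab' : (a : ℝ) + 1 ≤ b := by exact_mod_cast hab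
    obtain ⟨t, ht, hte⟩ := hoc.out ha hb (show (a : ℝ) + 1 / 2 ∈ Set.Icc (a : ℝ) b by
      constructor <;> linarith)
    obtain ⟨n, hn⟩ := hint t ht
    rw [hφn t ht n hn] at hte
    have : (2 * n : ℝ) = 2 * a + 1 := by linarith
    norm_cast at this
    omega
  have m0 : (n0 : ℝ) ∈ φ '' Set.Icc 0 1 := ⟨0, h0, hφn 0 h0 n0 hn0⟩
  have m1 : (n1 : ℝ) ∈ φ '' Set.Icc 0 1 := ⟨1, h1, hφn 1 h1 n1 hn1⟩
  have : n0 = n1 := le_antisymm (not_lt.mp (key _ _ m1 m0)) (not_lt.mp (key _ _ m0 m1))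
  subst this
  rw [hn0, hn1]
  ring

/-- `w` is the total change of a continuous logarithm of `γ - p` along the path `γ`. -/
def IsLogChange (γ : ℝ → ℂ) (p w : ℂ) : Prop :=
  ∃ ℓ : ℝ → ℂ, ContinuousOn ℓ (Set.Icc 0 1) ∧
    (∀ t ∈ Set.Icc (0 : ℝ) 1, Complex.exp (ℓ t) = γ t - p) ∧ w = ℓ 1 - ℓ 0

lemma IsLogChange.unique {γ : ℝ → ℂ} {p w w' : ℂ} (h : IsLogChange γ p w)
    (h' : IsLogChange γ p w') : w = w' := by
  obtain ⟨ℓ, hc, he, rfl⟩ := h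
  obtain ⟨ℓ', hc', he', rfl⟩ := h'
  exact log_lift_sub_eq hc hc' he he'

/-- The change of the logarithm around a square, for two disjoint paths. -/
lemma exists_isLogChange_square {e g : ℝ → ℂ} (he : Continuous e) (hg : Continuous g)
    (hne : ∀ s t, e s ≠ g t) :
    ∃ a b c d : ℂ, IsLogChange g (e 0) a ∧ IsLogChange e (g 1) b ∧ IsLogChange e (g 0) c ∧
      IsLogChange g (e 1) d ∧ a + b = c + d := by
  obtain ⟨L, hL, hexp⟩ := exists_continuousOn_log (fun x : ℝ × ℝ => g x.2 - e x.1)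
    (by fun_prop) fun x => sub_ne_zero.mpr (hne _ _).symm
  have hmem : ∀ s ∈ Set.Icc (0 : ℝ) 1, ∀ t ∈ Set.Icc (0 : ℝ) 1,
      ((s, t) : ℝ × ℝ) ∈ Metric.closedBall (0 : ℝ × ℝ) 1 := by
    intro s hs t ht
    rw [mem_closedBall_zero_iff, Prod.norm_def]
    simp only [Real.norm_eq_abs, sup_le_iff]
    rw [abs_of_nonneg hs.1, abs_of_nonneg ht.1]
    exact ⟨hs.2, ht.2⟩
  have h0 : (0 : ℝ) ∈ Set.Icc (0 : ℝ) 1 := by simp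
  have h1 : (1 : ℝ) ∈ Set.Icc (0 : ℝ) 1 := by simp
  have hpi : Complex.exp (Real.pi * Complex.I) = -1 := Complex.exp_pi_mul_I
  have hg' : ∀ s ∈ Set.Icc (0 : ℝ) 1, IsLogChange g (e s) (L (s, 1) - L (s, 0)) := by
    intro s hs
    refine ⟨fun t => L (s, t), ?_, fun t ht => hexp _ (hmem s hs t ht), rfl⟩
    exact hL.comp (by fun_prop) fun t ht => hmem s hs t ht
  have he' : ∀ t ∈ Set.Icc (0 : ℝ) 1, IsLogChange e (g t) (L (1, t) - L (0, t)) := by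
    intro t ht
    -- The constant `π i` turns a logarithm of `g t - e s` into one of `e s - g t`.
    refine ⟨fun s => L (s, t) + Real.pi * Complex.I, ?_, fun s hs => ?_, by ring⟩
    · exact (hL.comp (by fun_prop) fun s hs => hmem s hs t ht).add continuousOn_const
    · rw [Complex.exp_add, hpi, hexp _ (hmem s hs t ht)]
      ring
  exact ⟨_, _, _, _, hg' 0 h0, he' 1 h1, he' 0 h0, hg' 1 h1, by ring⟩

lemma IsLogChange.exists_int {γ : ℝ → ℂ} {p w : ℂ} (h : IsLogChange γ p w) :
    ∃ n : ℤ, w = Complex.log (γ 1 - p) - Complex.log (γ 0 - p)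
      + n * (2 * Real.pi * Complex.I) := by
  obtain ⟨ℓ, -, he, rfl⟩ := h
  have key : ∀ t ∈ Set.Icc (0 : ℝ) 1,
      ∃ n : ℤ, ℓ t = Complex.log (γ t - p) + n * (2 * Real.pi * Complex.I) := by
    intro t ht
    apply Complex.exp_eq_exp_iff_exists_int.mp
    rw [he t ht, Complex.exp_log]
    rw [← he t ht]
    exact Complex.exp_ne_zero _
  obtain ⟨n0, h0⟩ := key 0 (by simp)
  obtain ⟨n1, h1⟩ := key 1 (by simp)
  refine ⟨n1 - n0, ?_⟩
  rw [h0, h1]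
  push_cast
  ring

open Classical in
/-- The number of full turns of `γ` around `p`, relative to the principal logarithm. -/
noncomputable def turns (p : ℂ) (γ : ℝ → ℂ) : ℤ :=
  if h : ∃ n : ℤ, IsLogChange γ p (Complex.log (γ 1 - p) - Complex.log (γ 0 - p)
      + n * (2 * Real.pi * Complex.I)) then h.choose else 0

lemma IsLogChange.eq_turns {γ : ℝ → ℂ} {p w : ℂ} (h : IsLogChange γ p w) :
    w = Complex.log (γ 1 - p) - Complex.log (γ 0 - p)
      + turns p γ * (2 * Real.pi * Complex.I) := by
  obtain ⟨n, rfl⟩ := h.exists_int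
  have hex : ∃ n : ℤ, IsLogChange γ p (Complex.log (γ 1 - p) - Complex.log (γ 0 - p)
      + n * (2 * Real.pi * Complex.I)) := ⟨n, h⟩
  rw [turns, dif_pos hex]
  exact h.unique hex.choose_spec

lemma exists_flip {x y : ℂ} (h : x ≠ y) : ∃ k : ℤ,
    Complex.log (y - x) - Complex.log (x - y) = (2 * k + 1) * (Real.pi * Complex.I) := by
  have : Complex.exp (Complex.log (y - x)) =
      Complex.exp (Complex.log (x - y) + Real.pi * Complex.I) := by
    rw [Complex.exp_add, Complex.exp_pi_mul_I, Complex.exp_log (sub_ne_zero.mpr h.symm),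
      Complex.exp_log (sub_ne_zero.mpr h)]
    ring
  obtain ⟨n, hn⟩ := Complex.exp_eq_exp_iff_exists_int.mp this
  exact ⟨n, by rw [hn]; ring⟩

open Classical in
/-- The integer `k` with `log (y - x) - log (x - y) = (2 k + 1) π i`. -/
noncomputable def flip (x y : ℂ) : ℤ :=
  if h : x ≠ y then (exists_flip h).choose else 0

lemma flip_spec {x y : ℂ} (h : x ≠ y) : Complex.log (y - x) - Complex.log (x - y)
    = (2 * flip x y + 1) * (Real.pi * Complex.I) := by
  rw [flip, dif_pos h]
  exact (exists_flip h).choose_spec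

/-- Swapping the points negates the odd number `2 * flip x y + 1`. The resulting `-1` is the source
of the parity contradiction. -/
lemma flip_swap {x y : ℂ} (h : x ≠ y) : flip y x = - flip x y - 1 := by
  have h1 := flip_spec h
  have h2 := flip_spec h.symm
  have h3 : (2 * (flip x y + flip y x + 1 : ℂ)) * (Real.pi * Complex.I) = 0 := by
    linear_combination -h1 - h2
  have h4 : (flip x y + flip y x + 1 : ℂ) = 0 := by
    have : (Real.pi * Complex.I : ℂ) ≠ 0 := by simp [Real.pi_ne_zero]
    simpa [this] using h3
  have h5 : flip x y + flip y x + 1 = 0 := by exact_mod_cast h4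
  omega

/-- The changes of a logarithm of `g t - e s` along the sides of the square cancel. The principal
logarithms at the corners do not: each corner difference occurs with both signs, once for either
path, and `flip` records the discrepancy. -/
lemma turns_square {e g : ℝ → ℂ} {x y u w : ℂ} (he : Continuous e) (hg : Continuous g)
    (hne : ∀ s t, e s ≠ g t) (hx : e 0 = x) (hy : e 1 = y) (hu : g 0 = u) (hw : g 1 = w) :
    turns x g + turns w e - turns u e - turns y g =
      - (flip x w + flip w y + flip y u + flip u x + 2) := by
  obtain ⟨a, b, c, d, ha, hb, hc, hd, habcd⟩ := exists_isLogChange_square he hg hne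
  rw [ha.eq_turns, hb.eq_turns, hc.eq_turns, hd.eq_turns] at habcd
  have h1 := flip_spec (hne 0 1)
  have h2 := flip_spec (hne 1 1).symm
  have h3 := flip_spec (hne 1 0)
  have h4 := flip_spec (hne 0 0).symm
  rw [hx, hy, hu, hw] at *
  have h5 : ((turns x g + turns w e - turns u e - turns y g +
      (flip x w + flip w y + flip y u + flip u x + 2) : ℤ) : ℂ) * (2 * (Real.pi * Complex.I)) = 0 := by
    push_cast
    linear_combination habcd - h1 - h2 - h3 - h4
  have h6 : (2 * (Real.pi * Complex.I) : ℂ) ≠ 0 := by simp [Real.pi_ne_zero]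
  have h7 := (mul_eq_zero.mp h5).resolve_right h6
  have h8 : turns x g + turns w e - turns u e - turns y g +
      (flip x w + flip w y + flip y u + flip u x + 2) = 0 := by exact_mod_cast h7
  omega

/-- There is no drawing of `K₃,₃` by paths such that independent edges are disjoint. -/
theorem not_drawing_completeBipartite (p q : Fin 3 → ℂ) (γ : Fin 3 → Fin 3 → ℝ → ℂ)
    (hc : ∀ i j, Continuous (γ i j)) (h0 : ∀ i j, γ i j 0 = p i) (h1 : ∀ i j, γ i j 1 = q j)
    (hdisj : ∀ i j k l, i ≠ k → j ≠ l → ∀ s t, γ i j s ≠ γ k l t)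
    (hpq : ∀ i j, p i ≠ q j) : False := by
  have hp : ∀ i j, i ≠ j → p i ≠ p j := by
    intro i j hij
    have := hdisj i 0 j 1 hij (by decide) 0 0
    rwa [h0, h0] at this
  have hq : ∀ i j, i ≠ j → q i ≠ q j := by
    intro i j hij
    have := hdisj 0 i 1 j (by decide) hij 1 1
    rwa [h1, h1] at this
  have key : ∀ i j k l, i ≠ k → j ≠ l → _ := fun i j k l hik hjl =>
    turns_square (hc i j) (hc k l) (hdisj i j k l hik hjl) (h0 i j) (h1 i j) (h0 k l) (h1 k l)
  have s01 := flip_swap (hp 0 1 (by decide))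
  have s02 := flip_swap (hp 0 2 (by decide))
  have s12 := flip_swap (hp 1 2 (by decide))
  have r01 := flip_swap (hq 0 1 (by decide))
  have r02 := flip_swap (hq 0 2 (by decide))
  have r12 := flip_swap (hq 1 2 (by decide))
  have t00 := flip_swap (hpq 0 0)
  have t01 := flip_swap (hpq 0 1)
  have t02 := flip_swap (hpq 0 2)
  have t10 := flip_swap (hpq 1 0)
  have t11 := flip_swap (hpq 1 1)
  have t12 := flip_swap (hpq 1 2)
  have t20 := flip_swap (hpq 2 0)
  have t21 := flip_swap (hpq 2 1)
  have t22 := flip_swap (hpq 2 2)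
  -- One relation for each of the 18 unordered pairs of independent edges. In their sum every
  -- `turns` term is even, since a vertex off an edge has exactly two edges independent of it,
  -- whereas `flip_swap` makes the right-hand side odd.
  have k1 := key 0 0 1 1 (by decide) (by decide)
  have k2 := key 0 0 1 2 (by decide) (by decide)
  have k3 := key 0 1 1 0 (by decide) (by decide)
  have k4 := key 0 1 1 2 (by decide) (by decide)
  have k5 := key 0 2 1 0 (by decide) (by decide)
  have k6 := key 0 2 1 1 (by decide) (by decide)
  have k7 := key 0 0 2 1 (by decide) (by decide)
  have k8 := key 0 0 2 2 (by decide) (by decide)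
  have k9 := key 0 1 2 0 (by decide) (by decide)
  have k10 := key 0 1 2 2 (by decide) (by decide)
  have k11 := key 0 2 2 0 (by decide) (by decide)
  have k12 := key 0 2 2 1 (by decide) (by decide)
  have k13 := key 1 0 2 1 (by decide) (by decide)
  have k14 := key 1 0 2 2 (by decide) (by decide)
  have k15 := key 1 1 2 0 (by decide) (by decide)
  have k16 := key 1 1 2 2 (by decide) (by decide)
  have k17 := key 1 2 2 0 (by decide) (by decide)
  have k18 := key 1 2 2 1 (by decide) (by decide)
  clear key hp hq hdisj hpq h0 h1 hc
  omega

/-- There is no drawing of `K₅` by paths such that independent edges are disjoint. -/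
theorem not_drawing_complete (p : Fin 5 → ℂ) (γ : Fin 5 → Fin 5 → ℝ → ℂ)
    (hc : ∀ i j, i < j → Continuous (γ i j)) (h0 : ∀ i j, i < j → γ i j 0 = p i)
    (h1 : ∀ i j, i < j → γ i j 1 = p j)
    (hdisj : ∀ i j k l, i < j → k < l → i ≠ k → i ≠ l → j ≠ k → j ≠ l →
      ∀ s t, γ i j s ≠ γ k l t)
    (hp : ∀ i j, i < j → p i ≠ p j) : False := by
  have key : ∀ i j k l, i < j → k < l → i < k → i ≠ l → j ≠ k → j ≠ l → _ :=
    fun i j k l hij hkl hik hil hjk hjl =>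
    turns_square (hc i j hij) (hc k l hkl) (hdisj i j k l hij hkl hik.ne hil hjk hjl) (h0 i j hij)
      (h1 i j hij) (h0 k l hkl) (h1 k l hkl)
  have s01 := flip_swap (hp 0 1 (by decide))
  have s02 := flip_swap (hp 0 2 (by decide))
  have s03 := flip_swap (hp 0 3 (by decide))
  have s04 := flip_swap (hp 0 4 (by decide))
  have s12 := flip_swap (hp 1 2 (by decide))
  have s13 := flip_swap (hp 1 3 (by decide))
  have s14 := flip_swap (hp 1 4 (by decide))
  have s23 := flip_swap (hp 2 3 (by decide))
  have s24 := flip_swap (hp 2 4 (by decide))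
  have s34 := flip_swap (hp 3 4 (by decide))
  -- The same parity count over the 15 pairs of independent edges of `K₅`.
  have k1 := key 0 1 2 3 (by decide) (by decide) (by decide) (by decide) (by decide) (by decide)
  have k2 := key 0 1 2 4 (by decide) (by decide) (by decide) (by decide) (by decide) (by decide)
  have k3 := key 0 1 3 4 (by decide) (by decide) (by decide) (by decide) (by decide) (by decide)
  have k4 := key 0 2 1 3 (by decide) (by decide) (by decide) (by decide) (by decide) (by decide)
  have k5 := key 0 2 1 4 (by decide) (by decide) (by decide) (by decide) (by decide) (by decide)
  have k6 := key 0 2 3 4 (by decide) (by decide) (by decide) (by decide) (by decide) (by decide)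
  have k7 := key 0 3 1 2 (by decide) (by decide) (by decide) (by decide) (by decide) (by decide)
  have k8 := key 0 3 1 4 (by decide) (by decide) (by decide) (by decide) (by decide) (by decide)
  have k9 := key 0 3 2 4 (by decide) (by decide) (by decide) (by decide) (by decide) (by decide)
  have k10 := key 0 4 1 2 (by decide) (by decide) (by decide) (by decide) (by decide) (by decide)
  have k11 := key 0 4 1 3 (by decide) (by decide) (by decide) (by decide) (by decide) (by decide)
  have k12 := key 0 4 2 3 (by decide) (by decide) (by decide) (by decide) (by decide) (by decide)
  have k13 := key 1 2 3 4 (by decide) (by decide) (by decide) (by decide) (by decide) (by decide)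
  have k14 := key 1 3 2 4 (by decide) (by decide) (by decide) (by decide) (by decide) (by decide)
  have k15 := key 1 4 2 3 (by decide) (by decide) (by decide) (by decide) (by decide) (by decide)
  clear key hp hdisj h0 h1 hc
  omega

end GraphDrawing

/-! ### Minor models, and the topological obstruction to outerplanarity -/

namespace GraphDrawing

/-- `S` induces a connected subgraph of `G` (or is empty): no proper nonempty part of `S` is cut
off. -/
def Conn {V : Type*} (G : SimpleGraph V) (S : Set V) : Prop :=
  ∀ T : Set V, (S ∩ T).Nonempty → (S \ T).Nonempty → ∃ x ∈ S ∩ T, ∃ y ∈ S \ T, G.Adj x y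

/-- A model of `H` as a minor of `G`, with branch sets `B`. -/
structure IsMinorModel {V W : Type*} (H : SimpleGraph W) (G : SimpleGraph V) (B : W → Set V) :
    Prop where
  nonempty : ∀ w, (B w).Nonempty
  conn : ∀ w, Conn G (B w)
  disjoint : ∀ w w', w ≠ w' → Disjoint (B w) (B w')
  adj : ∀ w w', H.Adj w w' → ∃ x ∈ B w, ∃ y ∈ B w', G.Adj x y

section Conn

variable {V : Type*} {G : SimpleGraph V}

lemma conn_singleton (v : V) : Conn G {v} := by
  rintro T ⟨x, rfl, hx⟩ ⟨y, rfl, hy⟩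
  exact absurd hx hy

lemma Conn.mono {G' : SimpleGraph V} (h : G ≤ G') {S : Set V} (hS : Conn G S) : Conn G' S := by
  intro T h1 h2
  obtain ⟨x, hx, y, hy, hxy⟩ := hS T h1 h2
  exact ⟨x, hx, y, hy, h hxy⟩

lemma Conn.union {S T : Set V} (hS : Conn G S) (hT : Conn G T)
    (h : ∃ x ∈ S, ∃ y ∈ T, G.Adj x y) : Conn G (S ∪ T) := by
  obtain ⟨a, ha, b, hb, hab⟩ := h
  intro U h1 h2
  have push : ∀ {R : Set V}, R ⊆ S ∪ T → (∃ x ∈ R ∩ U, ∃ y ∈ R \ U, G.Adj x y) →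
      ∃ x ∈ (S ∪ T) ∩ U, ∃ y ∈ (S ∪ T) \ U, G.Adj x y := by
    rintro R hR ⟨x, hx, y, hy, hxy⟩
    exact ⟨x, ⟨hR hx.1, hx.2⟩, y, ⟨hR hy.1, hy.2⟩, hxy⟩
  by_contra hcon
  have hS' : ¬ ((S ∩ U).Nonempty ∧ (S \ U).Nonempty) := fun h =>
    hcon (push Set.subset_union_left (hS U h.1 h.2))
  have hT' : ¬ ((T ∩ U).Nonempty ∧ (T \ U).Nonempty) := fun h =>
    hcon (push Set.subset_union_right (hT U h.1 h.2))
  by_cases haU : a ∈ U <;> by_cases hbU : b ∈ U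
  · obtain ⟨y, hy | hy, hyU⟩ := h2
    · exact hS' ⟨⟨a, ha, haU⟩, ⟨y, hy, hyU⟩⟩
    · exact hT' ⟨⟨b, hb, hbU⟩, ⟨y, hy, hyU⟩⟩
  · exact hcon ⟨a, ⟨Or.inl ha, haU⟩, b, ⟨Or.inr hb, hbU⟩, hab⟩
  · exact hcon ⟨b, ⟨Or.inr hb, hbU⟩, a, ⟨Or.inl ha, haU⟩, hab.symm⟩
  · obtain ⟨y, hy | hy, hyU⟩ := h1
    · exact hS' ⟨⟨y, hy, hyU⟩, ⟨a, ha, haU⟩⟩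
    · exact hT' ⟨⟨y, hy, hyU⟩, ⟨b, hb, hbU⟩⟩

end Conn

/-! ### Subdrawings carried by vertex sets -/

section Drawing

variable {V : Type*} {G : SimpleGraph V} {pos : V → Plane} {arc : Sym2 V → Set Plane}

/-- The part of a drawing covered by the subgraph induced on `S`. -/
def carrierOn (G : SimpleGraph V) (pos : V → Plane) (arc : Sym2 V → Set Plane) (S : Set V) :
    Set Plane :=
  pos '' S ∪ ⋃ e ∈ {e | e ∈ G.edgeSet ∧ ∀ v ∈ e, v ∈ S}, arc e

lemma carrierOn_mono {S T : Set V} (h : S ⊆ T) :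
    carrierOn G pos arc S ⊆ carrierOn G pos arc T :=
  Set.union_subset_union (Set.image_mono h)
    (Set.biUnion_subset_biUnion_left fun _ he => ⟨he.1, fun v hv => h (he.2 v hv)⟩)

lemma carrierOn_subset_carrier (S : Set V) : carrierOn G pos arc S ⊆ carrier G pos arc :=
  Set.union_subset_union (Set.image_subset_range _ _)
    (Set.biUnion_subset_biUnion_left fun _ he => he.1)

variable (hd : IsPlanarDrawing G pos arc)
include hd

lemma IsPlanarDrawing.isCompact_arc {e : Sym2 V} (he : e ∈ G.edgeSet) : IsCompact (arc e) := by
  induction e using Sym2.ind with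
  | _ u v =>
    obtain ⟨γ, -, hγ⟩ := hd.isArc u v he
    rw [← hγ]
    exact isCompact_range γ.continuous

lemma IsPlanarDrawing.isCompact_carrierOn [Finite V] (S : Set V) :
    IsCompact (carrierOn G pos arc S) :=
  ((Set.toFinite S).image pos).isCompact.union
    ((Set.toFinite _).isCompact_biUnion fun _ he => hd.isCompact_arc he.1)

lemma IsPlanarDrawing.isCompact_carrier [Finite V] : IsCompact (carrier G pos arc) :=
  (Set.finite_range pos).isCompact.union
    ((Set.toFinite _).isCompact_biUnion fun _ he => hd.isCompact_arc he)

lemma IsPlanarDrawing.mem_of_pos_mem_carrierOn {S : Set V} {w : V}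
    (h : pos w ∈ carrierOn G pos arc S) : w ∈ S := by
  rcases h with ⟨v, hv, hvw⟩ | h
  · rwa [← hd.pos_injective hvw]
  · simp only [Set.mem_iUnion] at h
    obtain ⟨e, he, hw⟩ := h
    exact he.2 _ (hd.vertex_mem e he.1 w hw)

lemma IsPlanarDrawing.disjoint_carrierOn {S T : Set V} (h : Disjoint S T) :
    Disjoint (carrierOn G pos arc S) (carrierOn G pos arc T) := by
  rw [Set.disjoint_left] at h ⊢
  intro x hxS hxT
  rcases hxS with ⟨v, hv, rfl⟩ | hxS
  · exact h hv (hd.mem_of_pos_mem_carrierOn hxT)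
  rcases hxT with ⟨v, hv, rfl⟩ | hxT
  · exact h (hd.mem_of_pos_mem_carrierOn (Or.inr hxS)) hv
  simp only [Set.mem_iUnion] at hxS hxT
  obtain ⟨e, he, hxe⟩ := hxS
  obtain ⟨f, hf, hxf⟩ := hxT
  have hef : e ≠ f := by
    rintro rfl
    induction e using Sym2.ind with
    | _ u v => exact h (he.2 u (by simp)) (hf.2 u (by simp))
  obtain ⟨w, hw, -⟩ := hd.inter_subset e he.1 f hf.1 hef ⟨hxe, hxf⟩
  exact h (he.2 w hw.1) (hf.2 w hw.2)

/-- No edge inside `S` leaves the set of vertices reachable from `u` within the carrier, so this set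
exhausts the connected set `S`. -/
lemma IsPlanarDrawing.joinedIn_carrierOn {S : Set V} (hS : Conn G S) {u v : V} (hu : u ∈ S)
    (hv : v ∈ S) : JoinedIn (carrierOn G pos arc S) (pos u) (pos v) := by
  by_contra hcon
  obtain ⟨x, hx, y, hy, hxy⟩ := hS {w | JoinedIn (carrierOn G pos arc S) (pos u) (pos w)}
    ⟨u, hu, JoinedIn.refl (Or.inl ⟨u, hu, rfl⟩)⟩ ⟨v, hv, hcon⟩
  refine hy.2 (JoinedIn.trans hx.2 ?_)
  obtain ⟨γ, -, hγ⟩ := hd.isArc x y hxy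
  refine ⟨γ, fun t => Or.inr ?_⟩
  simp only [Set.mem_iUnion]
  refine ⟨s(x, y), ⟨hxy, ?_⟩, hγ ▸ ⟨t, rfl⟩⟩
  intro w hw
  rcases Sym2.mem_iff.mp hw with rfl | rfl
  exacts [hx.1, hy.1]

end Drawing

lemma isPathConnected_norm_gt {R : ℝ} (hR : 0 ≤ R) : IsPathConnected {x : Plane | R < ‖x‖} := by
  have h1 : IsPathConnected (Metric.sphere (0 : Plane) 1) :=
    isPathConnected_sphere (by
      rw [rank_eq_card_basis (EuclideanSpace.basisFun (Fin 2) ℝ).toBasis]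
      simp) 0 zero_le_one
  have h2 : IsPathConnected (Set.Ioi R) := (convex_Ioi R).isPathConnected ⟨R + 1, by simp⟩
  have h3 := (h2.prod h1).image (f := fun q : ℝ × Plane => q.1 • q.2) (by fun_prop)
  convert h3 using 1
  ext x
  constructor
  · intro hx
    have hx' : 0 < ‖x‖ := hR.trans_lt hx
    refine ⟨(‖x‖, ‖x‖⁻¹ • x), ⟨hx, ?_⟩, ?_⟩
    · simp [norm_smul, hx'.ne']
    · simp [smul_smul, hx'.ne']
  · rintro ⟨⟨t, y⟩, ⟨ht, hy⟩, rfl⟩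
    have ht' : R < t := ht
    have hy' : ‖y‖ = 1 := by simpa using hy
    simp only [Set.mem_ofPred_eq, norm_smul, hy', Real.norm_eq_abs, mul_one]
    exact ht'.trans_le (le_abs_self t)

/-- Each component in `outerFace S` is unbounded and so leaves a disc containing `S`; the exterior
of the disc is path-connected. -/
lemma joinedIn_compl_of_mem_outerFace {S : Set Plane} (hS : IsCompact S) {x y : Plane}
    (hx : x ∈ outerFace S) (hy : y ∈ outerFace S) : JoinedIn Sᶜ x y := by
  obtain ⟨R, hR⟩ := hS.isBounded.subset_closedBall 0
  have hR0 : ∀ z : Plane, max R 0 < ‖z‖ → z ∈ Sᶜ := by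
    intro z hz hzS
    have := hR hzS
    rw [mem_closedBall_zero_iff] at this
    exact absurd hz (not_lt.mpr (this.trans (le_max_left _ _)))
  have key : ∀ w ∈ outerFace S, ∃ z, max R 0 < ‖z‖ ∧ JoinedIn Sᶜ w z := by
    intro w hw
    have hopen : IsOpen (connectedComponentIn Sᶜ w) := hS.isClosed.isOpen_compl.connectedComponentIn
    have hconn : IsConnected (connectedComponentIn Sᶜ w) := isConnected_connectedComponentIn_iff.mpr hw.1
    have hpath := hopen.isConnected_iff_isPathConnected.mp hconn
    have : ∃ z ∈ connectedComponentIn Sᶜ w, max R 0 < ‖z‖ := by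
      by_contra hcon
      push Not at hcon
      exact hw.2 (Metric.isBounded_closedBall.subset fun z hz =>
        mem_closedBall_zero_iff.mpr (hcon z hz))
    obtain ⟨z, hz, hzR⟩ := this
    exact ⟨z, hzR, (hpath.joinedIn w (mem_connectedComponentIn hw.1) z hz).mono
      (connectedComponentIn_subset _ _)⟩
  obtain ⟨x', hx', hxx'⟩ := key x hx
  obtain ⟨y', hy', hyy'⟩ := key y hy
  exact (hxx'.trans (((isPathConnected_norm_gt (le_max_right R 0)).joinedIn x' hx' y' hy').mono
    hR0)).trans hyy'.symm

/-- The identification of the Euclidean plane with the complex plane. -/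
noncomputable def toComplex (x : Plane) : ℂ := ⟨x 0, x 1⟩

lemma continuous_toComplex : Continuous toComplex := by
  have : toComplex = fun x : Plane => (x 0 : ℂ) + (x 1 : ℂ) * Complex.I := by
    funext x
    apply Complex.ext <;> simp [toComplex]
  rw [this]
  fun_prop

lemma toComplex_injective : Function.Injective toComplex := by
  intro x y h
  have h0 := congrArg Complex.re h
  have h1 := congrArg Complex.im h
  ext i
  fin_cases i
  exacts [h0, h1]

/-- The path is extended by constants beyond `[0, 1]`, so containment in `F`, and later
disjointness, holds for all real parameters. -/
lemma exists_curve {F : Set Plane} {x y : Plane} (h : JoinedIn F x y) :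
    ∃ γ : ℝ → ℂ, Continuous γ ∧ γ 0 = toComplex x ∧ γ 1 = toComplex y ∧
      ∀ t, γ t ∈ toComplex '' F := by
  refine ⟨fun t => toComplex (h.somePath.extend t),
    continuous_toComplex.comp h.somePath.continuous_extend, by simp, by simp, fun t => ?_⟩
  refine ⟨_, ?_, rfl⟩
  have : h.somePath.extend t ∈ Set.range h.somePath.extend := ⟨t, rfl⟩
  rw [Path.extend_range] at this
  obtain ⟨s, hs⟩ := this
  rw [← hs]
  exact h.somePath_mem s

/-- A minor model in an outerplanar graph yields curves for the edges of `H` and for the edges from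
an apex `z` to all vertices of `H`, such that independent edges are disjoint. -/
lemma IsOuterplanar.exists_apex_curves {V W : Type*} [Finite V] [Nonempty W] {G : SimpleGraph V}
    (hG : IsOuterplanar G) {H : SimpleGraph W} {B : W → Set V} (hB : IsMinorModel H G B) :
    ∃ (z : ℂ) (p : W → ℂ) (δ : W → ℝ → ℂ) (γ : W → W → ℝ → ℂ),
      (∀ i, Continuous (δ i) ∧ δ i 0 = z ∧ δ i 1 = p i) ∧
      (∀ i j, H.Adj i j → Continuous (γ i j) ∧ γ i j 0 = p i ∧ γ i j 1 = p j) ∧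
      (∀ i, z ≠ p i) ∧ Function.Injective p ∧
      (∀ i j k l, H.Adj i j → H.Adj k l → i ≠ k → i ≠ l → j ≠ k → j ≠ l →
        ∀ s t, γ i j s ≠ γ k l t) ∧
      (∀ i j k, H.Adj i j → i ≠ k → j ≠ k → ∀ s t, γ i j s ≠ δ k t) := by
  obtain ⟨pos, arc, hd, hout⟩ := hG
  choose r hr using hB.nonempty
  set S := carrier G pos arc with hS
  have hSc : IsCompact S := hd.isCompact_carrier
  have hclos : ∀ v, pos v ∈ closure (outerFace S) := fun v => frontier_subset_closure (hout v)
  obtain ⟨z, hz⟩ : (outerFace S).Nonempty :=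
    closure_nonempty_iff.mp ⟨_, hclos (r (Classical.arbitrary W))⟩
  have hposS : ∀ v, pos v ∈ S := fun v => Or.inl ⟨v, rfl⟩
  -- The curve stays off the drawing until it is close to the representative of `B k`, then ends
  -- inside a ball that misses everything drawn on the complement of `B k`. In that ball it may meet
  -- edges at `B k`, which are not required to be disjoint from it.
  have hδ : ∀ k, ∃ δ : ℝ → ℂ, Continuous δ ∧ δ 0 = toComplex z ∧ δ 1 = toComplex (pos (r k)) ∧
      ∀ t, δ t ∈ toComplex '' (carrierOn G pos arc (B k)ᶜ)ᶜ := by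
    intro k
    have hnot : pos (r k) ∈ (carrierOn G pos arc (B k)ᶜ)ᶜ := fun h =>
      hd.mem_of_pos_mem_carrierOn h (hr k)
    have hopen : IsOpen (carrierOn G pos arc (B k)ᶜ)ᶜ :=
      (hd.isCompact_carrierOn _).isClosed.isOpen_compl
    obtain ⟨ε, hε, hball⟩ := Metric.isOpen_iff.mp hopen _ hnot
    obtain ⟨y, hy, hdist⟩ := Metric.mem_closure_iff.mp (hclos (r k)) ε hε
    refine exists_curve (((joinedIn_compl_of_mem_outerFace hSc hz hy).mono ?_).trans
      ((?_ : JoinedIn (Metric.ball (pos (r k)) ε) y (pos (r k))).mono hball))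
    · exact Set.compl_subset_compl.mpr (carrierOn_subset_carrier _)
    · refine (((convex_ball (pos (r k)) ε).isPathConnected ⟨_, Metric.mem_ball_self hε⟩).joinedIn
        _ ?_ _ (Metric.mem_ball_self hε))
      rwa [Metric.mem_ball, dist_comm]
  choose δ hδ using hδ
  -- Staying in the part drawn on `B i ∪ B j` suffices: independent edges of `H` then use disjoint
  -- vertex sets.
  have hγ : ∀ i j, ∃ γ : ℝ → ℂ, H.Adj i j → Continuous γ ∧ γ 0 = toComplex (pos (r i)) ∧
      γ 1 = toComplex (pos (r j)) ∧ ∀ t, γ t ∈ toComplex '' carrierOn G pos arc (B i ∪ B j) := by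
    intro i j
    by_cases hij : H.Adj i j
    · obtain ⟨γ, h⟩ := exists_curve (hd.joinedIn_carrierOn
        ((hB.conn i).union (hB.conn j) (hB.adj i j hij)) (Or.inl (hr i)) (Or.inr (hr j)))
      exact ⟨γ, fun _ => h⟩
    · exact ⟨0, fun h => absurd h hij⟩
  choose γ hγ using hγ
  refine ⟨toComplex z, fun i => toComplex (pos (r i)), δ, γ, fun i => ⟨(hδ i).1, (hδ i).2.1,
    (hδ i).2.2.1⟩, fun i j hij => ⟨(hγ i j hij).1, (hγ i j hij).2.1, (hγ i j hij).2.2.1⟩, ?_, ?_,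
    ?_, ?_⟩
  · intro i h
    have := toComplex_injective h
    exact hz.1 (this ▸ hposS (r i))
  · intro i j h
    have h' := hd.pos_injective (toComplex_injective h)
    by_contra hij
    exact Set.disjoint_left.mp (hB.disjoint i j hij) (hr i) (h' ▸ hr j)
  · intro i j k l hij hkl hik hil hjk hjl s t hst
    obtain ⟨x, hx, hxs⟩ := (hγ i j hij).2.2.2 s
    obtain ⟨y, hy, hyt⟩ := (hγ k l hkl).2.2.2 t
    have hxy : x = y := toComplex_injective (by rw [hxs, hyt, hst])
    refine Set.disjoint_left.mp (hd.disjoint_carrierOn ?_) hx (hxy ▸ hy)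
    simp only [Set.disjoint_union_left, Set.disjoint_union_right]
    exact ⟨⟨hB.disjoint _ _ hik, hB.disjoint _ _ hjk⟩, hB.disjoint _ _ hil, hB.disjoint _ _ hjl⟩
  · intro i j k hij hik hjk s t hst
    obtain ⟨x, hx, hxs⟩ := (hγ i j hij).2.2.2 s
    obtain ⟨y, hy, hyt⟩ := (hδ k).2.2.2 t
    have hxy : x = y := toComplex_injective (by rw [hxs, hyt, hst])
    refine hy (hxy ▸ carrierOn_mono ?_ hx)
    rw [Set.union_subset_iff]
    exact ⟨(hB.disjoint _ _ hik).subset_compl_right, (hB.disjoint _ _ hjk).subset_compl_right⟩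

/-- An outerplanar graph has no `K₄` minor. -/
theorem IsOuterplanar.not_isMinorModel_complete {V : Type*} [Finite V] {G : SimpleGraph V}
    (hG : IsOuterplanar G) (B : Fin 4 → Set V) : ¬ IsMinorModel ⊤ G B := by
  intro hB
  obtain ⟨z, p, δ, γ, hδ, hγ, hz, hp, h1, h2⟩ := hG.exists_apex_curves hB
  -- Vertex 0 of `K₅` is the apex. The default curves `0` belong to pairs with second index 0,
  -- excluded by `i < j`.
  refine not_drawing_complete (Fin.cons z p)
    (fun i j => Fin.cases (fun j => Fin.cases 0 δ j) (fun i j => Fin.cases 0 (γ i) j) i j)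
    ?_ ?_ ?_ ?_ ?_
  · intro i j hij
    cases i using Fin.cases <;> cases j using Fin.cases
    · exact absurd hij (lt_irrefl _)
    · exact (hδ _).1
    · exact absurd hij (Fin.not_lt_zero _)
    · exact (hγ _ _ (by simpa using hij.ne)).1
  · intro i j hij
    cases i using Fin.cases <;> cases j using Fin.cases
    · exact absurd hij (lt_irrefl _)
    · exact (hδ _).2.1
    · exact absurd hij (Fin.not_lt_zero _)
    · exact (hγ _ _ (by simpa using hij.ne)).2.1
  · intro i j hij
    cases i using Fin.cases <;> cases j using Fin.cases
    · exact absurd hij (lt_irrefl _)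
    · exact (hδ _).2.2
    · exact absurd hij (Fin.not_lt_zero _)
    · exact (hγ _ _ (by simpa using hij.ne)).2.2
  · intro i j k l hij hkl hik hil hjk hjl s t
    cases j using Fin.cases with
    | zero => exact absurd hij (Fin.not_lt_zero _)
    | succ j =>
    cases l using Fin.cases with
    | zero => exact absurd hkl (Fin.not_lt_zero _)
    | succ l =>
    have hjl' : j ≠ l := fun h => hjl (by rw [h])
    cases i using Fin.cases with
    | zero =>
      cases k using Fin.cases with
      | zero => exact absurd rfl hik
      | succ k =>
        exact (h2 k l j (by simpa using hkl.ne) (fun h => hjk (by rw [h])) hjl'.symm t s).symm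
    | succ i =>
      have hij' : i ≠ j := by simpa using hij.ne
      cases k using Fin.cases with
      | zero => exact h2 i j l hij' (fun h => hil (by rw [h])) hjl' s t
      | succ k =>
        exact h1 i j k l hij' (by simpa using hkl.ne) (fun h => hik (by rw [h]))
          (fun h => hil (by rw [h])) (fun h => hjk (by rw [h])) hjl' s t
  · intro i j hij
    cases i using Fin.cases <;> cases j using Fin.cases
    · exact absurd hij (lt_irrefl _)
    · exact hz _
    · exact absurd hij (Fin.not_lt_zero _)
    · exact fun h => hij.ne (congrArg Fin.succ (hp h))

/-- An outerplanar graph has no `K₂,₃` minor. -/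
theorem IsOuterplanar.not_isMinorModel_completeBipartite {V : Type*} [Finite V]
    {G : SimpleGraph V} (hG : IsOuterplanar G) (B : Fin 2 ⊕ Fin 3 → Set V) :
    ¬ IsMinorModel (completeBipartiteGraph (Fin 2) (Fin 3)) G B := by
  intro hB
  obtain ⟨z, p, δ, γ, hδ, hγ, hz, hp, h1, h2⟩ := hG.exists_apex_curves hB
  have hadj : ∀ i j, (completeBipartiteGraph (Fin 2) (Fin 3)).Adj (.inl i) (.inr j) := by simp
  -- The apex joins the side of size two, turning `K₂,₃` into `K₃,₃`; its curves to that side are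
  -- not needed.
  refine not_drawing_completeBipartite (Fin.cons z fun i => p (.inl i)) (fun j => p (.inr j))
    (fun i j => Fin.cases (δ (.inr j)) (fun i => γ (.inl i) (.inr j)) i) ?_ ?_ ?_ ?_ ?_
  · intro i j
    cases i using Fin.cases
    · exact (hδ _).1
    · exact (hγ _ _ (hadj _ _)).1
  · intro i j
    cases i using Fin.cases
    · exact (hδ _).2.1
    · exact (hγ _ _ (hadj _ _)).2.1
  · intro i j
    cases i using Fin.cases
    · exact (hδ _).2.2
    · exact (hγ _ _ (hadj _ _)).2.2
  · intro i j k l hik hjl s t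
    have hjl' : (.inr j : Fin 2 ⊕ Fin 3) ≠ .inr l := by simpa using hjl
    cases i using Fin.cases with
    | zero =>
      cases k using Fin.cases with
      | zero => exact absurd rfl hik
      | succ k => exact (h2 _ _ _ (hadj k l) (by simp) hjl'.symm t s).symm
    | succ i =>
      cases k using Fin.cases with
      | zero => exact h2 _ _ _ (hadj i j) (by simp) hjl' s t
      | succ k =>
        exact h1 _ _ _ _ (hadj i j) (hadj k l) (by simpa using hik) (by simp) (by simp) hjl' s t
  · intro i j
    cases i using Fin.cases
    · exact hz _
    · exact fun h => by simpa using hp h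

end GraphDrawing

/-! ### Noncrossing linear orders of graphs without `K₄` and `K₂,₃` minors -/

namespace GraphDrawing

/-- `f` places the vertices on a line such that no two edges, drawn as half circles above the line,
cross. -/
def Noncrossing {V : Type*} (G : SimpleGraph V) (f : V → ℝ) : Prop :=
  ∀ x y z w, G.Adj x y → G.Adj z w → ¬ (f x < f z ∧ f z < f y ∧ f y < f w)

/-! ### Operations on linear orders and on minor models -/

section

variable {V : Type*} {G H : SimpleGraph V}

/-- Moving the vertices before `c` behind all others. -/
lemma Noncrossing.exists_rotate [Finite V] {f : V → ℝ} (hf : Noncrossing G f)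
    (hinj : Function.Injective f) (c : ℝ) :
    ∃ M : ℝ, (∀ x y, f x < f y + M) ∧
      Function.Injective (fun x => if f x < c then f x + M else f x) ∧
      Noncrossing G (fun x => if f x < c then f x + M else f x) := by
  obtain ⟨A, hA⟩ := (Set.finite_range f).bddAbove
  obtain ⟨B, hB⟩ := (Set.finite_range f).bddBelow
  have hM : ∀ x y, f x < f y + (A - B + 1) := by
    intro x y
    have h1 := hA ⟨x, rfl⟩
    have h2 := hB ⟨y, rfl⟩
    linarith
  refine ⟨A - B + 1, hM, ?_, ?_⟩
  · intro x y hxy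
    apply hinj
    have h1 := hM x y
    have h2 := hM y x
    dsimp only at hxy
    split_ifs at hxy <;> linarith
  · intro x y z w hxy hzw ⟨h1, h2, h3⟩
    have m1 := hM z x
    have m2 := hM y z
    have m3 := hM w y
    dsimp only at h1 h2 h3
    -- Crossing depends only on the cyclic order, so a crossing after rotation is one before it,
    -- with the four ends renamed.
    split_ifs at h1 h2 h3 with a1 a2 a3 a4 a5 a6 a7 a8 <;> first
      | (exfalso; linarith)
      | (exact hf x y z w hxy hzw ⟨by linarith, by linarith, by linarith⟩)
      | (exact hf w z x y hzw.symm hxy ⟨by linarith, by linarith, by linarith⟩)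
      | (exact hf y x w z hxy.symm hzw.symm ⟨by linarith, by linarith, by linarith⟩)
      | (exact hf z w y x hzw hxy.symm ⟨by linarith, by linarith, by linarith⟩)

/-- Inserting a vertex right after the position `τ`. -/
lemma exists_noncrossing_insert [Finite V] {f : V → ℝ} (hinj : Function.Injective f) (v : V)
    (τ : ℝ)
    (hf : ∀ x y z w, x ≠ v → y ≠ v → z ≠ v → w ≠ v → G.Adj x y → G.Adj z w →
      ¬ (f x < f z ∧ f z < f y ∧ f y < f w))
    (hl : ∀ y s t, G.Adj v y → G.Adj s t → s ≠ v → t ≠ v → f y < f s → f s ≤ τ →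
      f y ≤ f t ∧ f t ≤ τ)
    (hr : ∀ y s t, G.Adj v y → G.Adj s t → s ≠ v → t ≠ v → τ < f s → f s < f y →
      τ < f t ∧ f t ≤ f y) :
    ∃ f' : V → ℝ, Function.Injective f' ∧ Noncrossing G f' := by
  classical
  obtain ⟨c, hc, hgap⟩ : ∃ c, τ < c ∧ ∀ x, f x ≤ τ ∨ c < f x := by
    by_cases hne : {x | τ < f x}.Nonempty
    · obtain ⟨x, hx, hmin⟩ := Set.exists_min_image _ f (Set.toFinite {x | τ < f x}) hne
      have hx' : τ < f x := hx
      refine ⟨(τ + f x) / 2, by linarith, fun y => ?_⟩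
      rcases le_or_gt (f y) τ with h | h
      · exact Or.inl h
      · have := hmin y h
        exact Or.inr (by linarith)
    · refine ⟨τ + 1, by linarith, fun x => Or.inl (not_lt.mp fun h => hne ⟨x, h⟩)⟩
  have hlt : ∀ x, f x < c → f x ≤ τ := fun x h => (hgap x).resolve_right (not_lt.mpr h.le)
  have hfc : ∀ x, f x ≠ c := fun x h => by
    rcases hgap x with h' | h' <;> linarith
  have hv : ∀ x, x ≠ v → Function.update f v c x = f x := fun x h => Function.update_of_ne h _ _
  have hvv : Function.update f v c v = c := Function.update_self _ _ _
  refine ⟨Function.update f v c, ?_, ?_⟩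
  · intro x y hxy
    by_cases hx : x = v <;> by_cases hy : y = v
    · rw [hx, hy]
    · rw [hx, hvv, hv y hy] at hxy
      exact absurd hxy.symm (hfc y)
    · rw [hy, hvv, hv x hx] at hxy
      exact absurd hxy (hfc x)
    · rw [hv x hx, hv y hy] at hxy
      exact hinj hxy
  · intro x y z w hxy hzw ⟨h1, h2, h3⟩
    have hxz : x ≠ z := fun h => by rw [h] at h1; exact lt_irrefl _ h1
    have hzy : z ≠ y := fun h => by rw [h] at h2; exact lt_irrefl _ h2
    have hyw : y ≠ w := fun h => by rw [h] at h3; exact lt_irrefl _ h3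
    have hxw : x ≠ w := fun h => by rw [h] at h1; exact lt_irrefl _ (h1.trans (h2.trans h3))
    by_cases hx : x = v
    · subst hx
      rw [hv z hxz.symm, hvv] at h1
      rw [hv z hxz.symm, hv y hxy.ne'] at h2
      rw [hv y hxy.ne', hv w hxw.symm] at h3
      have := hr y z w hxy hzw hxz.symm hxw.symm (hc.trans h1) h2
      linarith
    by_cases hy : y = v
    · subst hy
      rw [hv x hx, hv z hzy] at h1
      rw [hv z hzy, hvv] at h2
      rw [hv w hyw.symm, hvv] at h3
      have := hl x z w hxy.symm hzw hzy hyw.symm h1 (hlt z h2)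
      linarith
    by_cases hz : z = v
    · subst hz
      rw [hv x hx, hvv] at h1
      rw [hv y hy, hvv] at h2
      rw [hv y hy, hv w hzw.ne'] at h3
      have := hr w y x hzw hxy.symm hy hx (hc.trans h2) h3
      have := hlt x h1
      linarith
    by_cases hw : w = v
    · subst hw
      rw [hv x hx, hv z hz] at h1
      rw [hv y hy, hv z hz] at h2
      rw [hv y hy, hvv] at h3
      have := hl z y x hzw.symm hxy.symm hy hx h2 (hlt y h3)
      linarith
    rw [hv x hx, hv z hz] at h1
    rw [hv z hz, hv y hy] at h2
    rw [hv y hy, hv w hw] at h3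
    exact hf x y z w hx hy hz hw hxy hzw ⟨h1, h2, h3⟩

/-- If no connected set under the edge `ab` is adjacent to both `a` and `b`, then some vertical line
crosses the edge `ab` only. -/
lemma Noncrossing.exists_gap [Finite V] {f : V → ℝ} (hf : Noncrossing H f)
    (hinj : Function.Injective f) {a b : V} (hlt : f a < f b)
    (hM : ¬ ∃ M : Set V, (∀ x ∈ M, f a < f x ∧ f x < f b) ∧ Conn H M ∧ (∃ y ∈ M, H.Adj a y) ∧
      ∃ y ∈ M, H.Adj b y) :
    ∃ τ, f a ≤ τ ∧ τ < f b ∧ ∀ s t, H.Adj s t → f a ≤ f s → f s ≤ τ → τ < f t → f t ≤ f b →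
      s = a ∧ t = b := by
  -- `R` consists of the vertices reachable from `a` strictly under the edge `ab`. The gap opens
  -- right after the last vertex `p` of `R`, or after `a` if `R` is empty.
  set R : Set V := {x | ∃ M : Set V, (∀ x ∈ M, f a < f x ∧ f x < f b) ∧ Conn H M ∧
    (∃ y ∈ M, H.Adj a y) ∧ x ∈ M} with hR
  obtain ⟨p, hp, hmax⟩ := Set.exists_max_image (insert a R) f (Set.toFinite _) ⟨a, by simp⟩
  have hpb : f p < f b := by
    rcases hp with rfl | ⟨M, hMI, -, -, hpM⟩
    · exact hlt
    · exact (hMI p hpM).2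
  refine ⟨f p, hmax a (by simp), hpb, ?_⟩
  intro s t hst has hsp hpt htb
  have htR : t ∉ R := fun h => absurd hpt (not_lt.mpr (hmax t (Or.inr h)))
  have hat : f a < f t := (hmax a (by simp)).trans_lt hpt
  by_cases hs : s ∈ insert a R
  · by_cases htb' : t = b
    · subst htb'
      rcases hs with rfl | ⟨M, hMI, hMc, hMa, hsM⟩
      · exact ⟨rfl, rfl⟩
      · exact absurd ⟨M, hMI, hMc, hMa, s, hsM, hst.symm⟩ hM
    · have htb'' : f t < f b := lt_of_le_of_ne htb fun h => htb' (hinj h)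
      refine absurd ?_ htR
      rcases hs with rfl | ⟨M, hMI, hMc, ⟨y, hyM, hay⟩, hsM⟩
      · refine ⟨{t}, ?_, conn_singleton t, ⟨t, rfl, hst⟩, rfl⟩
        rintro x rfl
        exact ⟨hat, htb''⟩
      · refine ⟨M ∪ {t}, ?_, hMc.union (conn_singleton t) ⟨s, hsM, t, rfl, hst⟩,
          ⟨y, Or.inl hyM, hay⟩, Or.inr rfl⟩
        rintro x (hx | rfl)
        · exact hMI x hx
        · exact ⟨hat, htb''⟩
  -- Here `s` is skipped by the connected set leading from `a` to `p`. Some edge of that connection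
  -- passes over `s` and ends before `t`, so it crosses `st`.
  · exfalso
    have hsa : s ≠ a := fun h => hs (Or.inl h)
    have hsp' : s ≠ p := fun h => hs (h ▸ hp)
    have has' : f a < f s := lt_of_le_of_ne has fun h => hsa (hinj h).symm
    have hsp'' : f s < f p := lt_of_le_of_ne hsp fun h => hsp' (hinj h)
    rcases hp with rfl | ⟨M, hMI, hMc, ⟨y, hyM, hay⟩, hpM⟩
    · linarith
    have hMR : ∀ x ∈ M, x ∈ R := fun x hx => ⟨M, hMI, hMc, ⟨y, hyM, hay⟩, hx⟩
    have hsM : ∀ x ∈ M, f x ≠ f s := fun x hx h => hs (Or.inr (hinj h ▸ hMR x hx))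
    have hMp : ∀ x ∈ M, f x < f t := fun x hx => (hmax x (Or.inr (hMR x hx))).trans_lt hpt
    rcases lt_or_gt_of_ne (hsM y hyM) with hys | hys
    · obtain ⟨x, hx, x', hx', hxx'⟩ := hMc {x | f x < f s} ⟨y, hyM, hys⟩
        ⟨p, hpM, fun h => absurd hsp'' (not_lt.mpr (le_of_lt h))⟩
      have : f s < f x' := lt_of_le_of_ne (not_lt.mp hx'.2) (hsM x' hx'.1).symm
      exact hf x x' s t hxx' hst ⟨hx.2, this, hMp x' hx'.1⟩
    · exact hf a y s t hay hst ⟨has', hys, hMp y hyM⟩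

/-- The graph `G` with the vertex `v` isolated. -/
def isolate (G : SimpleGraph V) (v : V) : SimpleGraph V where
  Adj x y := G.Adj x y ∧ x ≠ v ∧ y ≠ v
  symm := ⟨fun _ _ h => ⟨h.1.symm, h.2.2, h.2.1⟩⟩
  loopless := ⟨fun _ h => h.1.ne rfl⟩

/-- The graph `G` with the vertex `v` isolated and the edge `ab` added. -/
def suppress (G : SimpleGraph V) (v : V) {a b : V} (hab : a ≠ b) : SimpleGraph V where
  Adj x y := (G.Adj x y ∧ x ≠ v ∧ y ≠ v) ∨ (x = a ∧ y = b) ∨ (x = b ∧ y = a)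
  symm := ⟨fun x y h => by
    rcases h with h | h | h
    · exact Or.inl ⟨h.1.symm, h.2.2, h.2.1⟩
    · exact Or.inr (Or.inr h.symm)
    · exact Or.inr (Or.inl h.symm)⟩
  loopless := ⟨fun x h => by
    rcases h with h | h | h
    · exact h.1.ne rfl
    · exact hab (h.1.symm.trans h.2)
    · exact hab (h.2.symm.trans h.1)⟩

lemma IsMinorModel.mono {W : Type*} {K : SimpleGraph W} {B : W → Set V} (hB : IsMinorModel K H B)
    (h : H ≤ G) : IsMinorModel K G B where
  nonempty := hB.nonempty
  conn w := (hB.conn w).mono h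
  disjoint := hB.disjoint
  adj w w' hw := by
    obtain ⟨x, hx, y, hy, hxy⟩ := hB.adj w w' hw
    exact ⟨x, hx, y, hy, h hxy⟩

/-- Suppressing a vertex of degree two does not create minors. -/
lemma IsMinorModel.of_suppress {W : Type*} {K : SimpleGraph W} {B : W → Set V} {v a b : V}
    {hab : a ≠ b} (hva : G.Adj v a) (hvb : G.Adj v b)
    (hB : IsMinorModel K (suppress G v hab) B) (hK : ∀ w, ∃ w', K.Adj w w') :
    ∃ B' : W → Set V, IsMinorModel K G B' := by
  have hiso : ∀ x, ¬ (suppress G v hab).Adj v x := by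
    rintro x (h | h | h)
    · exact h.2.1 rfl
    · exact hva.ne h.1
    · exact hvb.ne h.1
  -- Suppression isolates `v`, so a branch set containing it would be `{v}` and have no outside
  -- neighbour, while `w` has a neighbour in `K`.
  have hvB : ∀ w, v ∉ B w := by
    intro w hw
    obtain ⟨w', hww'⟩ := hK w
    obtain ⟨x, hx, y, hy, hxy⟩ := hB.adj w w' hww'
    have hxv : x ≠ v := fun h => hiso y (h ▸ hxy)
    obtain ⟨s, hs, t, ht, hst⟩ := hB.conn w {v} ⟨v, hw, rfl⟩ ⟨x, hx, hxv⟩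
    have : s = v := hs.2
    exact hiso t (this ▸ hst)
  -- `v` joins the branch set of `a`, if there is one; the edge `vb` then takes over the role of
  -- `ab`.
  refine ⟨fun w => B w ∪ {x | x = v ∧ a ∈ B w}, ⟨fun w => (hB.nonempty w).inl, ?_, ?_, ?_⟩⟩
  · intro w
    by_cases ha : a ∈ B w
    · intro T h1 h2
      have hvm : v ∈ B w ∪ {x | x = v ∧ a ∈ B w} := Or.inr ⟨rfl, ha⟩
      by_cases haT : a ∈ T <;> by_cases hvT : v ∈ T
      · have h2' : (B w \ T).Nonempty := by
          obtain ⟨y, hy | ⟨rfl, -⟩, hyT⟩ := h2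
          · exact ⟨y, hy, hyT⟩
          · exact absurd hvT hyT
        obtain ⟨x, hx, y, hy, hxy⟩ := hB.conn w T ⟨a, ha, haT⟩ h2'
        rcases hxy with h | ⟨rfl, rfl⟩ | ⟨rfl, rfl⟩
        · exact ⟨x, ⟨Or.inl hx.1, hx.2⟩, y, ⟨Or.inl hy.1, hy.2⟩, h.1⟩
        · exact ⟨v, ⟨hvm, hvT⟩, y, ⟨Or.inl hy.1, hy.2⟩, hvb⟩
        · exact absurd haT hy.2
      · exact ⟨a, ⟨Or.inl ha, haT⟩, v, ⟨hvm, hvT⟩, hva.symm⟩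
      · exact ⟨v, ⟨hvm, hvT⟩, a, ⟨Or.inl ha, haT⟩, hva⟩
      · have h1' : (B w ∩ T).Nonempty := by
          obtain ⟨y, hy | ⟨rfl, -⟩, hyT⟩ := h1
          · exact ⟨y, hy, hyT⟩
          · exact absurd hyT hvT
        obtain ⟨x, hx, y, hy, hxy⟩ := hB.conn w T h1' ⟨a, ha, haT⟩
        rcases hxy with h | ⟨rfl, rfl⟩ | ⟨rfl, rfl⟩
        · exact ⟨x, ⟨Or.inl hx.1, hx.2⟩, y, ⟨Or.inl hy.1, hy.2⟩, h.1⟩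
        · exact absurd hx.2 haT
        · exact ⟨x, ⟨Or.inl hx.1, hx.2⟩, v, ⟨hvm, hvT⟩, hvb.symm⟩
    · have : B w ∪ {x | x = v ∧ a ∈ B w} = B w := by
        ext x
        simp [ha]
      rw [this]
      intro T h1 h2
      obtain ⟨x, hx, y, hy, hxy⟩ := hB.conn w T h1 h2
      rcases hxy with h | ⟨rfl, rfl⟩ | ⟨rfl, rfl⟩
      · exact ⟨x, hx, y, hy, h.1⟩
      · exact absurd hx.1 ha
      · exact absurd hy.1 ha
  · intro w w' hww'
    have hd := Set.disjoint_left.mp (hB.disjoint w w' hww')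
    rw [Set.disjoint_left]
    rintro x (hx | ⟨hxv, hx⟩) (hx' | ⟨hxv', hx'⟩)
    · exact hd hx hx'
    · exact hvB _ (hxv' ▸ hx)
    · exact hvB _ (hxv ▸ hx')
    · exact hd hx hx'
  · intro w w' hww'
    obtain ⟨x, hx, y, hy, hxy⟩ := hB.adj w w' hww'
    rcases hxy with h | ⟨rfl, rfl⟩ | ⟨rfl, rfl⟩
    · exact ⟨x, Or.inl hx, y, Or.inl hy, h.1⟩
    · exact ⟨v, Or.inr ⟨rfl, hx⟩, y, Or.inl hy, hvb⟩
    · exact ⟨x, Or.inl hx, v, Or.inr ⟨rfl, hy⟩, hvb.symm⟩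

/-- Three disjoint connected sets adjacent to both `a` and `b` form a `K₂,₃` minor. -/
lemma isMinorModel_theta {a b v : V} {M N : Set V} (hab : a ≠ b) (hva : G.Adj v a)
    (hvb : G.Adj v b) (haM : a ∉ M) (hbM : b ∉ M) (hvM : v ∉ M) (haN : a ∉ N) (hbN : b ∉ N)
    (hvN : v ∉ N) (hMN : Disjoint M N) (hM : Conn G M) (hN : Conn G N) (h1 : ∃ y ∈ M, G.Adj a y)
    (h2 : ∃ y ∈ M, G.Adj b y) (h3 : ∃ y ∈ N, G.Adj a y) (h4 : ∃ y ∈ N, G.Adj b y) :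
    IsMinorModel (completeBipartiteGraph (Fin 2) (Fin 3)) G
      (Sum.elim ![{a}, {b}] ![{v}, M, N]) := by
  have hM0 : M.Nonempty := let ⟨y, hy, _⟩ := h1; ⟨y, hy⟩
  have hN0 : N.Nonempty := let ⟨y, hy, _⟩ := h3; ⟨y, hy⟩
  have hav : a ≠ v := hva.ne'
  have hbv : b ≠ v := hvb.ne'
  have hadj : ∀ i j, ∃ x ∈ (![{a}, {b}] : Fin 2 → Set V) i, ∃ y ∈ (![{v}, M, N] : Fin 3 → Set V) j,
      G.Adj x y := by
    intro i j
    fin_cases i <;> fin_cases j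
    · exact ⟨a, rfl, v, rfl, hva.symm⟩
    · exact ⟨a, rfl, h1⟩
    · exact ⟨a, rfl, h3⟩
    · exact ⟨b, rfl, v, rfl, hvb.symm⟩
    · exact ⟨b, rfl, h2⟩
    · exact ⟨b, rfl, h4⟩
  refine ⟨?_, ?_, ?_, ?_⟩
  · rintro (i | i) <;> fin_cases i <;> simp [hM0, hN0]
  · rintro (i | i) <;> fin_cases i <;> simp [hM, hN, conn_singleton]
  · rintro (i | i) (j | j) hij <;> fin_cases i <;> fin_cases j <;>
      first
      | exact absurd rfl hij
      | simp [hab, hab.symm, hav, hbv, hav.symm, hbv.symm, haM, hbM, hvM, haN, hbN, hvN, hMN,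
          hMN.symm]
  · rintro (i | i) (j | j) hij
    · simp at hij
    · exact hadj i j
    · obtain ⟨x, hx, y, hy, hxy⟩ := hadj j i
      exact ⟨y, hy, x, hx, hxy.symm⟩
    · simp at hij

/-- `p` traces a path with `k` edges. -/
def IsTrail (G : SimpleGraph V) (k : ℕ) (p : ℕ → V) : Prop :=
  (∀ i j, i ≤ k → j ≤ k → p i = p j → i = j) ∧ ∀ i < k, G.Adj (p i) (p (i + 1))

lemma IsTrail.conn_image {k : ℕ} {p : ℕ → V} (hp : IsTrail G k p) {l : ℕ} (n : ℕ)
    (h : l + n ≤ k) : Conn G (p '' Set.Icc l (l + n)) := by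
  induction n with
  | zero => simpa using conn_singleton _
  | succ n ih =>
    have : p '' Set.Icc l (l + (n + 1)) = p '' Set.Icc l (l + n) ∪ {p (l + n + 1)} := by
      rw [← Set.image_singleton, ← Set.image_union]
      congr 1
      ext i
      simp only [Set.mem_Icc, Set.mem_union, Set.mem_singleton_iff]
      omega
    rw [this]
    exact (ih (by omega)).union (conn_singleton _)
      ⟨_, ⟨l + n, by simp, rfl⟩, _, rfl, hp.2 _ (by omega)⟩

/-- A nonempty graph without `K₄` minor has a vertex of degree one or two. -/
lemma exists_degree_le_two [Finite V] (hne : G ≠ ⊥)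
    (hK : ∀ B : Fin 4 → Set V, ¬ IsMinorModel ⊤ G B) :
    ∃ v a, G.Adj v a ∧ ((∀ y, G.Adj v y → y = a) ∨
      ∃ b, b ≠ a ∧ G.Adj v b ∧ ∀ y, G.Adj v y → y = a ∨ y = b) := by
  classical
  by_contra hcon
  push Not at hcon
  have hbound : ∀ k p, IsTrail G k p → k ≤ Nat.card V := by
    intro k p hp
    have hinj : Function.Injective (fun i : Fin (k + 1) => p i) := fun i j hij =>
      Fin.ext (hp.1 i j (by omega) (by omega) hij)
    have := Nat.card_le_card_of_injective _ hinj
    simp only [Nat.card_eq_fintype_card, Fintype.card_fin] at this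
    omega
  obtain ⟨u, w, huw⟩ := SimpleGraph.ne_bot_iff_exists_adj.mp hne
  have h1 : ∃ p, IsTrail G 1 p := by
    refine ⟨fun i => if i = 0 then u else w, ?_, ?_⟩
    · intro i j hi hj hij
      have := huw.ne
      have := huw.ne'
      dsimp only at hij
      split_ifs at hij <;> first | omega | contradiction
    · intro i hi
      obtain rfl : i = 0 := by omega
      simpa using huw
  set k := Nat.findGreatest (fun k => ∃ p, IsTrail G k p) (Nat.card V) with hk
  obtain ⟨q, hq⟩ : ∃ p, IsTrail G k p := by
    obtain ⟨p1, hp1⟩ := h1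
    exact Nat.findGreatest_spec (P := fun k => ∃ p, IsTrail G k p) (hbound 1 p1 hp1) ⟨p1, hp1⟩
  have hk1 : 1 ≤ k := by
    obtain ⟨p1, hp1⟩ := h1
    exact Nat.le_findGreatest (hbound 1 p1 hp1) ⟨p1, hp1⟩
  -- `k` is the length of a longest path, so all neighbours of the start of such a path lie on it.
  have hon : ∀ p, IsTrail G k p → ∀ y, G.Adj (p 0) y → ∃ i ≤ k, p i = y := by
    intro p hp y hy
    by_contra hno
    push Not at hno
    have hlong : IsTrail G (k + 1) (fun i => if i = 0 then y else p (i - 1)) := by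
      constructor
      · intro i j hi hj hij
        dsimp only at hij
        split_ifs at hij with h1 h2 h2
        · omega
        · exact absurd hij.symm (hno _ (by omega))
        · exact absurd hij (hno _ (by omega))
        · have := hp.1 _ _ (by omega) (by omega) hij
          omega
      · intro i hi
        rcases Nat.eq_zero_or_pos i with rfl | h
        · simpa using hy.symm
        · have := hp.2 (i - 1) (by omega)
          rw [Nat.sub_add_cancel h] at this
          simpa [h.ne'] using this
    have := Nat.le_findGreatest (P := fun k => ∃ p, IsTrail G k p) (hbound _ _ hlong) ⟨_, hlong⟩
    omega
  have hchord : ∃ i, ∃ p, IsTrail G k p ∧ 2 ≤ i ∧ i ≤ k ∧ G.Adj (p 0) (p i) := by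
    have h01 := hq.2 0 (by omega)
    obtain ⟨c, hc, hc1⟩ := (hcon _ _ h01).1
    obtain ⟨i, hi, rfl⟩ := hon q hq c hc
    have h0 : i ≠ 0 := fun h => hc.ne (by rw [h])
    have h1 : i ≠ 1 := fun h => hc1 (by rw [h])
    exact ⟨i, q, hq, by omega, hi, hc⟩
  -- The shortest chord at the start vertex is minimized over all longest paths, so that minimality
  -- also applies to the rerouted path below.
  set i := Nat.find hchord with hi
  obtain ⟨p, hp, hi2, hik, hpi⟩ := Nat.find_spec hchord
  rw [← hi] at hi2 hik hpi
  have hmin : ∀ p, IsTrail G k p → ∀ j, 2 ≤ j → j ≤ k → G.Adj (p 0) (p j) → i ≤ j :=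
    fun p hp j h2 hj hadj => Nat.find_min' hchord ⟨p, hp, h2, hj, hadj⟩
  have third : ∀ p, IsTrail G k p → G.Adj (p 0) (p i) → ∃ l, i < l ∧ l ≤ k ∧ G.Adj (p 0) (p l) := by
    intro p hp hpi
    have h01 := hp.2 0 (by omega)
    obtain ⟨c, hc, hc1, hc2⟩ := (hcon _ _ h01).2 (p i)
      (fun h => by have := hp.1 _ _ hik (by omega) h; omega) hpi
    obtain ⟨l, hl, rfl⟩ := hon p hp c hc
    have h0 : l ≠ 0 := fun h => hc.ne (by rw [h])
    have h1 : l ≠ 1 := fun h => hc1 (by rw [h])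
    have h2 : l ≠ i := fun h => hc2 (by rw [h])
    have := hmin p hp l (by omega) hl hc
    exact ⟨l, by omega, hl, hc⟩
  obtain ⟨l, hil, hlk, hpl⟩ := third p hp hpi
  -- Reversing the first `i` vertices and continuing along the chord to `p i` gives another longest
  -- path, starting at `p (i - 1)`.
  have hp' : IsTrail G k (fun j => if j < i then p (i - 1 - j) else p j) := by
    constructor
    · intro x y hx hy hxy
      dsimp only at hxy
      split_ifs at hxy with h1 h2 h2
      all_goals
        have := hp.1 _ _ (by omega) (by omega) hxy
        omega
    · intro x hx
      dsimp only
      split_ifs with h1 h2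
      · have := (hp.2 (i - 1 - (x + 1)) (by omega)).symm
        rwa [show i - 1 - (x + 1) + 1 = i - 1 - x by omega] at this
      · rw [show i - 1 - x = 0 by omega, show x + 1 = i by omega]
        exact hpi
      · omega
      · exact hp.2 x hx
  have hadj1 : G.Adj (p (i - 1)) (p i) := by
    have := hp.2 (i - 1) (by omega)
    rwa [show i - 1 + 1 = i by omega] at this
  obtain ⟨m, him, hmk, hpm⟩ := third _ hp' (by simpa [show 0 < i by omega] using hadj1)
  have hpm' : G.Adj (p (i - 1)) (p m) := by
    simpa [show 0 < i by omega, show ¬ m < i by omega] using hpm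
  have himg : ∀ A B : Set ℕ, (∀ x ∈ A, x ≤ k) → (∀ x ∈ B, x ≤ k) → (∀ x ∈ A, x ∉ B) →
      Disjoint (p '' A) (p '' B) := by
    intro A B hA hB hAB
    rw [Set.disjoint_left]
    rintro _ ⟨x, hx, rfl⟩ ⟨y, hy, hxy⟩
    exact hAB x hx (hp.1 _ _ (hB y hy) (hA x hx) hxy ▸ hy)
  -- The branch sets are `p 0`, the vertices between the ends of the chord, `p i`, and the tail. The
  -- third neighbours of `p 0` and `p (i - 1)` lie in the tail.
  set J : Fin 4 → Set ℕ := ![Set.Icc 0 0, Set.Icc 1 (1 + (i - 2)), Set.Icc i (i + 0),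
    Set.Icc (i + 1) (i + 1 + (k - i - 1))] with hJ
  have hJk : ∀ w, ∀ x ∈ J w, x ≤ k := by
    intro w x hx
    fin_cases w <;> simp [hJ] at hx <;> omega
  have hadj : ∀ w w' : Fin 4, w < w' → ∃ x ∈ p '' J w, ∃ y ∈ p '' J w', G.Adj x y := by
    have key : ∀ (w w' : Fin 4) (x y : ℕ), x ∈ J w → y ∈ J w' → G.Adj (p x) (p y) →
        ∃ x ∈ p '' J w, ∃ y ∈ p '' J w', G.Adj x y :=
      fun w w' x y hx hy h => ⟨_, ⟨x, hx, rfl⟩, _, ⟨y, hy, rfl⟩, h⟩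
    intro w w' hww'
    fin_cases w <;> fin_cases w' <;> first
      | exact absurd hww' (by decide)
      | skip
    · exact key 0 1 0 1 (by simp [hJ]) (by simp [hJ]) (hp.2 0 (by omega))
    · exact key 0 2 0 i (by simp [hJ]) (by simp [hJ]) hpi
    · exact key 0 3 0 l (by simp [hJ]) (by simp [hJ]; omega) hpl
    · exact key 1 2 (i - 1) i (by simp [hJ]; omega) (by simp [hJ]) hadj1
    · exact key 1 3 (i - 1) m (by simp [hJ]; omega) (by simp [hJ]; omega) hpm'
    · exact key 2 3 i (i + 1) (by simp [hJ]) (by simp [hJ]) (hp.2 i (by omega))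
  refine hK (fun w => p '' J w) ⟨?_, ?_, ?_, ?_⟩
  · intro w
    rw [Set.image_nonempty]
    fin_cases w <;> simp [hJ]
  · intro w
    fin_cases w
    · exact hp.conn_image (l := 0) 0 (by omega)
    · exact hp.conn_image (l := 1) (i - 2) (by omega)
    · exact hp.conn_image (l := i) 0 (by omega)
    · exact hp.conn_image (l := i + 1) (k - i - 1) (by omega)
  · intro w w' hww'
    refine himg _ _ (hJk w) (hJk w') ?_
    intro x hx hx'
    fin_cases w <;> fin_cases w' <;> simp [hJ] at hx hx' hww' <;> omega
  · intro w w' hww'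
    rcases lt_or_gt_of_ne hww'.ne with h | h
    · exact hadj w w' h
    · obtain ⟨x, hx, y, hy, hxy⟩ := hadj w' w h
      exact ⟨y, hy, x, hx, hxy.symm⟩

end

/-! ### Reinserting a vertex of degree one or two -/

section

variable {V : Type*} [Finite V] {G : SimpleGraph V}

/-- `v` is placed in the gap under `ab`. An old edge leaving the range between `v` and a neighbour
would cross `ab` or the vertical line of the gap. -/
lemma Noncrossing.extend_of_gap {H : SimpleGraph V} {f : V → ℝ} (hf : Noncrossing H f)
    (hinj : Function.Injective f) {v a b : V} (hab : H.Adj a b) (hlt : f a < f b)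
    (hGH : ∀ x y, G.Adj x y → x ≠ v → y ≠ v → H.Adj x y)
    (hv : ∀ y, G.Adj v y → y = a ∨ y = b)
    (hM : ¬ ∃ M : Set V, (∀ x ∈ M, f a < f x ∧ f x < f b) ∧ Conn H M ∧ (∃ y ∈ M, H.Adj a y) ∧
      ∃ y ∈ M, H.Adj b y) :
    ∃ f' : V → ℝ, Function.Injective f' ∧ Noncrossing G f' := by
  obtain ⟨τ, haτ, hτb, hgap⟩ := hf.exists_gap hinj hlt hM
  refine exists_noncrossing_insert hinj v τ ?_ ?_ ?_
  · intro x y z w hx hy hz hw hxy hzw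
    exact hf x y z w (hGH _ _ hxy hx hy) (hGH _ _ hzw hz hw)
  · intro y s t hy hst hs ht hys hsτ
    have hst' := hGH _ _ hst hs ht
    rcases hv y hy with rfl | rfl
    · by_contra hcon
      have hty : f y ≤ f t := by
        by_contra h
        exact hf t s y b hst'.symm hab ⟨not_le.mp h, hys, hsτ.trans_lt hτb⟩
      have htτ : τ < f t := not_le.mp fun h => hcon ⟨hty, h⟩
      have htb : f t ≤ f b := by
        by_contra h
        exact hf y b s t hab hst' ⟨hys, hsτ.trans_lt hτb, not_le.mp h⟩
      have := (hgap s t hst' hys.le hsτ htτ htb).1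
      rw [this] at hys
      exact lt_irrefl _ hys
    · linarith
  · intro y s t hy hst hs ht hτs hsy
    have hst' := hGH _ _ hst hs ht
    rcases hv y hy with rfl | rfl
    · linarith
    · by_contra hcon
      have hty : f t ≤ f y := by
        by_contra h
        exact hf a y s t hab hst' ⟨haτ.trans_lt hτs, hsy, not_le.mp h⟩
      have htτ : f t ≤ τ := not_lt.mp fun h => hcon ⟨h, hty⟩
      have hat : f a ≤ f t := by
        by_contra h
        exact hf t s a y hst'.symm hab ⟨not_le.mp h, haτ.trans_lt hτs, hsy⟩
      have := (hgap t s hst'.symm hat htτ hτs hsy.le).2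
      rw [this] at hsy
      exact lt_irrefl _ hsy

/-- In the cyclic order `ab` has two sides. If neither has room for `v`, each contains a connected
set adjacent to `a` and `b`, and with `{v}` these form a `K₂,₃` minor. -/
lemma Noncrossing.extend_suppress {v a b : V} {hab : a ≠ b} {f : V → ℝ}
    (hf : Noncrossing (suppress G v hab) f) (hinj : Function.Injective f) (hlt : f a < f b)
    (hva : G.Adj v a) (hvb : G.Adj v b) (hv : ∀ y, G.Adj v y → y = a ∨ y = b)
    (hK : ∀ B, ¬ IsMinorModel (completeBipartiteGraph (Fin 2) (Fin 3)) G B) :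
    ∃ f' : V → ℝ, Function.Injective f' ∧ Noncrossing G f' := by
  set H := suppress G v hab with hH
  have hHab : H.Adj a b := Or.inr (Or.inl ⟨rfl, rfl⟩)
  have hGH : ∀ x y, G.Adj x y → x ≠ v → y ≠ v → H.Adj x y := fun x y h hx hy => Or.inl ⟨h, hx, hy⟩
  have hHv : ∀ x, ¬ H.Adj v x := by
    rintro x (h | h | h)
    · exact h.2.1 rfl
    · exact hva.ne h.1
    · exact hvb.ne h.1
  have toG : ∀ M : Set V, a ∉ M → b ∉ M → Conn H M → (∃ y ∈ M, H.Adj a y) →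
      (∃ y ∈ M, H.Adj b y) →
      v ∉ M ∧ Conn G M ∧ (∃ y ∈ M, G.Adj a y) ∧ ∃ y ∈ M, G.Adj b y := by
    rintro M haM hbM hMc ⟨y, hyM, hay⟩ ⟨y', hyM', hby'⟩
    have hG : ∀ x z, z ∈ M → H.Adj x z → G.Adj x z := by
      rintro x z hz (h | ⟨rfl, rfl⟩ | ⟨rfl, rfl⟩)
      · exact h.1
      · exact absurd hz hbM
      · exact absurd hz haM
    refine ⟨fun hvM => ?_, fun T h1 h2 => ?_, ⟨y, hyM, hG _ _ hyM hay⟩, ⟨y', hyM', hG _ _ hyM' hby'⟩⟩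
    · have hyv : y ≠ v := fun h => hHv a (h ▸ hay.symm)
      obtain ⟨s, hs, t, ht, hst⟩ := hMc {v} ⟨v, hvM, rfl⟩ ⟨y, hyM, hyv⟩
      have : s = v := hs.2
      exact hHv t (this ▸ hst)
    · obtain ⟨x, hx, z, hz, hxz⟩ := hMc T h1 h2
      exact ⟨x, hx, z, hz, hG _ _ hz.1 hxz⟩
  by_cases hM : ∃ M : Set V, (∀ x ∈ M, f a < f x ∧ f x < f b) ∧ Conn H M ∧
      (∃ y ∈ M, H.Adj a y) ∧ ∃ y ∈ M, H.Adj b y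
  swap
  · exact hf.extend_of_gap hinj hHab hlt hGH hv hM
  -- Cutting the cyclic order just before `b` puts the other side of `ab` underneath the edge.
  obtain ⟨A, hA, hinj', hf'⟩ := hf.exists_rotate hinj (f b)
  set g : V → ℝ := fun x => if f x < f b then f x + A else f x with hg
  have hga : g a = f a + A := by simp [hg, hlt]
  have hgb : g b = f b := by simp [hg]
  have hlt' : g b < g a := by
    rw [hga, hgb]
    exact hA b a
  by_cases hN : ∃ N : Set V, (∀ x ∈ N, g b < g x ∧ g x < g a) ∧ Conn H N ∧
      (∃ y ∈ N, H.Adj b y) ∧ ∃ y ∈ N, H.Adj a y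
  swap
  · exact hf'.extend_of_gap hinj' hHab.symm hlt' hGH (fun y hy => (hv y hy).symm) hN
  obtain ⟨M, hMI, hMc, hMa, hMb⟩ := hM
  obtain ⟨N, hNI, hNc, hNb, hNa⟩ := hN
  have haM : a ∉ M := fun h => lt_irrefl _ (hMI a h).1
  have hbM : b ∉ M := fun h => lt_irrefl _ (hMI b h).2
  have haN : a ∉ N := fun h => lt_irrefl _ (hNI a h).2
  have hbN : b ∉ N := fun h => lt_irrefl _ (hNI b h).1
  have hMN : Disjoint M N := by
    rw [Set.disjoint_left]
    intro x hxM hxN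
    have h1 := hMI x hxM
    have h2 := (hNI x hxN).2
    simp only [hg, hlt, h1.2, if_true] at h2
    linarith
  obtain ⟨hvM, hMc', hMa', hMb'⟩ := toG M haM hbM hMc hMa hMb
  obtain ⟨hvN, hNc', hNa', hNb'⟩ := toG N haN hbN hNc hNa hNb
  exact absurd (isMinorModel_theta hab hva hvb haM hbM hvM haN hbN hvN hMN hMc' hNc' hMa' hMb' hNa'
    hNb') (hK _)

/-- A finite graph without `K₄` and `K₂,₃` minors has a noncrossing linear order. -/
theorem exists_noncrossing (n : ℕ) : ∀ G : SimpleGraph V, G.support.ncard = n →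
    (∀ B : Fin 4 → Set V, ¬ IsMinorModel ⊤ G B) →
    (∀ B, ¬ IsMinorModel (completeBipartiteGraph (Fin 2) (Fin 3)) G B) →
    ∃ f : V → ℝ, Function.Injective f ∧ Noncrossing G f := by
  -- The induction is on the number of non-isolated vertices; a deleted vertex stays in `V` as an
  -- isolated one.
  induction n using Nat.strong_induction_on with
  | _ n ih =>
    intro G hn hK4 hK23
    by_cases hG : G = ⊥
    · subst hG
      refine ⟨fun x => ((Finite.equivFin V x : ℕ) : ℝ), fun x y hxy => ?_, fun x y z w hxy => ?_⟩
      · exact (Finite.equivFin V).injective (Fin.ext (Nat.cast_injective hxy))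
      · exact absurd hxy (by simp)
    obtain ⟨v, a, hva, hdeg⟩ := exists_degree_le_two hG hK4
    have hless : ∀ H : SimpleGraph V, (∀ x, ¬ H.Adj v x) → H.support ⊆ G.support →
        H.support.ncard < n := by
      intro H hH hsub
      rw [← hn]
      refine Set.ncard_lt_ncard ⟨hsub, fun h => ?_⟩ (Set.toFinite _)
      obtain ⟨x, hx⟩ := h (show v ∈ G.support from ⟨a, hva⟩)
      exact hH x hx
    rcases hdeg with hdeg | ⟨b, hba, hvb, hdeg⟩
    · have hle : isolate G v ≤ G := fun x y h => h.1
      obtain ⟨f, hinj, hf⟩ := ih _ (hless (isolate G v) (fun x h => h.2.1 rfl)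
        (fun x ⟨y, hxy⟩ => ⟨y, hxy.1⟩)) _ rfl (fun B hB => hK4 B (hB.mono hle))
        (fun B hB => hK23 B (hB.mono hle))
      -- A leaf goes directly after its neighbour, so no vertex lies between them.
      refine exists_noncrossing_insert hinj v (f a) ?_ ?_ ?_
      · intro x y z w hx hy hz hw hxy hzw
        exact hf x y z w ⟨hxy, hx, hy⟩ ⟨hzw, hz, hw⟩
      · intro y s t hy _ _ _ h1 h2
        rw [hdeg y hy] at h1
        linarith
      · intro y s t hy _ _ _ h1 h2
        rw [hdeg y hy] at h2
        linarith
    · obtain ⟨f, hinj, hf⟩ := ih _ (hless (suppress G v hba.symm) (by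
          rintro x (h | h | h)
          · exact h.2.1 rfl
          · exact hva.ne h.1
          · exact hvb.ne h.1) (by
          rintro x ⟨y, h | ⟨rfl, -⟩ | ⟨rfl, -⟩⟩
          · exact ⟨y, h.1⟩
          · exact ⟨v, hva.symm⟩
          · exact ⟨v, hvb.symm⟩)) _ rfl
        (fun B hB => by
          obtain ⟨B', hB'⟩ := hB.of_suppress hva hvb (fun w => exists_ne w |>.imp fun _ h => h.symm)
          exact hK4 B' hB')
        (fun B hB => by
          obtain ⟨B', hB'⟩ := hB.of_suppress hva hvb (by
            rintro (i | i)
            · exact ⟨.inr 0, by simp⟩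
            · exact ⟨.inl 0, by simp⟩)
          exact hK23 B' hB')
      rcases lt_or_gt_of_ne (fun h => hba (hinj h).symm : f a ≠ f b) with hlt | hlt
      · exact hf.extend_suppress hinj hlt hva hvb hdeg hK23
      · have hsymm : suppress G v hba.symm = suppress G v hba := by
          ext x y
          simp only [suppress]
          tauto
        rw [hsymm] at hf
        exact hf.extend_suppress hinj hlt hvb hva (fun y hy => (hdeg y hy).symm) hK23

end

/-- A finite outerplanar bipartite graph has a noncrossing placement of the vertices on the natural
numbers such that adjacent vertices have different parities. -/
theorem IsOuterplanar.exists_noncrossing_nat {V : Type*} [Finite V] {G : SimpleGraph V}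
    (hG : IsOuterplanar G) (hbip : G.IsBipartite) :
    ∃ g : V → ℕ, Function.Injective g ∧ (∀ x y, G.Adj x y → Odd (g x + g y)) ∧
      ∀ x y z w, G.Adj x y → G.Adj z w → ¬ (g x < g z ∧ g z < g y ∧ g y < g w) := by
  obtain ⟨f, hinj, hf⟩ := exists_noncrossing _ G rfl hG.not_isMinorModel_complete
    hG.not_isMinorModel_completeBipartite
  obtain ⟨c⟩ := hbip
  have hmono : ∀ x y, f x < f y → {u | f u < f x}.ncard < {u | f u < f y}.ncard := by
    intro x y hxy
    refine Set.ncard_lt_ncard ⟨fun u hu => lt_trans hu hxy, fun h => ?_⟩ (Set.toFinite _)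
    have h' : f x < f x := h (show x ∈ {u | f u < f y} from hxy)
    exact lt_irrefl _ h'
  have hlt : ∀ x y, 2 * {u | f u < f x}.ncard + (c x : ℕ) < 2 * {u | f u < f y}.ncard + (c y : ℕ) ↔
      f x < f y := by
    intro x y
    have hcx := (c x).isLt
    have hcy := (c y).isLt
    constructor
    · intro h
      by_contra hcon
      rcases (not_lt.mp hcon).lt_or_eq with h' | h'
      · have := hmono y x h'
        omega
      · rw [hinj h'] at h
        omega
    · intro h
      have := hmono x y h
      omega
  refine ⟨fun x => 2 * {u | f u < f x}.ncard + (c x : ℕ), ?_, ?_, ?_⟩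
  · intro x y hxy
    by_contra hne
    rcases lt_or_gt_of_ne (fun h => hne (hinj h)) with h | h
    · exact absurd hxy ((hlt x y).mpr h).ne
    · exact absurd hxy ((hlt y x).mpr h).ne'
  · intro x y hxy
    have h1 : (c x : ℕ) ≠ c y := fun h => c.valid hxy (Fin.ext h)
    have hcx := (c x).isLt
    have hcy := (c y).isLt
    rw [Nat.odd_iff]
    dsimp only
    omega
  · intro x y z w hxy hzw ⟨h1, h2, h3⟩
    exact hf x y z w hxy hzw ⟨(hlt _ _).mp h1, (hlt _ _).mp h2, (hlt _ _).mp h3⟩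

end GraphDrawing

/-! ### Unit drawings of noncrossing graphs, glued from rhombi -/

namespace GraphDrawing

/-- The planar determinant of two vectors. -/
def det2 (p q : Plane) : ℝ := p 0 * q 1 - p 1 * q 0

lemma det2_comb (e a m r : Plane) (x y z : ℝ) :
    det2 e (x • a + y • m + z • r) = x * det2 e a + y * det2 e m + z * det2 e r := by
  simp [det2]
  ring

lemma det2_comm (p q : Plane) : det2 p q = - det2 q p := by
  simp only [det2]
  ring

lemma det2_self (p : Plane) : det2 p p = 0 := by
  simp [det2]
  ring

/-- The positions `pos` give a planar drawing of the graph `E` on the vertex set `S` by segments of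
length one, covering only points of `X`. -/
structure IsUnitDrawing {ι : Type*} (S : Set ι) (E : SimpleGraph ι) (pos : ι → Plane)
    (X : Set Plane) : Prop where
  injOn : Set.InjOn pos S
  mem_left : ∀ u v, E.Adj u v → u ∈ S
  vertex : ∀ u v w, E.Adj u v → w ∈ S → pos w ∈ segment ℝ (pos u) (pos v) → w = u ∨ w = v
  inter : ∀ u v u' v' z, E.Adj u v → E.Adj u' v' → s(u, v) ≠ s(u', v') →
    z ∈ segment ℝ (pos u) (pos v) → z ∈ segment ℝ (pos u') (pos v') →
    ∃ w, pos w = z ∧ (w = u ∨ w = v) ∧ (w = u' ∨ w = v')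
  unit : ∀ u v, E.Adj u v → dist (pos u) (pos v) = 1
  pos_mem : ∀ v ∈ S, pos v ∈ X
  segment_subset : ∀ u v, E.Adj u v → segment ℝ (pos u) (pos v) ⊆ X

/-! ### Unit drawings and their unions -/

namespace IsUnitDrawing

variable {ι : Type*} {S S₁ S₂ : Set ι} {E E₁ E₂ : SimpleGraph ι} {pos pos' : ι → Plane}
  {X X₁ X₂ : Set Plane}

lemma mem_right (h : IsUnitDrawing S E pos X) {u v : ι} (huv : E.Adj u v) : v ∈ S :=
  h.mem_left v u huv.symm

lemma mono (h : IsUnitDrawing S E pos X) (hX : X ⊆ X₁) : IsUnitDrawing S E pos X₁ :=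
  { h with
    pos_mem := fun v hv => hX (h.pos_mem v hv)
    segment_subset := fun u v huv => (h.segment_subset u v huv).trans hX }

lemma congr (h : IsUnitDrawing S E pos X) (heq : ∀ v ∈ S, pos' v = pos v) :
    IsUnitDrawing S E pos' X where
  injOn := h.injOn.congr fun v hv => (heq v hv).symm
  mem_left := h.mem_left
  vertex u v w huv hw := by
    rw [heq u (h.mem_left u v huv), heq v (h.mem_right huv), heq w hw]
    exact h.vertex u v w huv hw
  inter u v u' v' z huv huv' := by
    rw [heq u (h.mem_left u v huv), heq v (h.mem_right huv), heq u' (h.mem_left u' v' huv'),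
      heq v' (h.mem_right huv')]
    intro hne hz hz'
    obtain ⟨w, hw, hw1, hw2⟩ := h.inter u v u' v' z huv huv' hne hz hz'
    refine ⟨w, ?_, hw1, hw2⟩
    rw [heq w, hw]
    rcases hw1 with rfl | rfl
    exacts [h.mem_left _ _ huv, h.mem_right huv]
  unit u v huv := by
    rw [heq u (h.mem_left u v huv), heq v (h.mem_right huv)]
    exact h.unit u v huv
  pos_mem v hv := by
    rw [heq v hv]
    exact h.pos_mem v hv
  segment_subset u v huv := by
    rw [heq u (h.mem_left u v huv), heq v (h.mem_right huv)]
    exact h.segment_subset u v huv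

/-- Two drawings meeting only in common vertices can be united. -/
lemma union (h₁ : IsUnitDrawing S₁ E₁ pos X₁) (h₂ : IsUnitDrawing S₂ E₂ pos X₂)
    (hX : ∀ z ∈ X₁, z ∈ X₂ → ∃ y ∈ S₁, y ∈ S₂ ∧ pos y = z) :
    IsUnitDrawing (S₁ ∪ S₂) (E₁ ⊔ E₂) pos (X₁ ∪ X₂) := by
  have v12 : ∀ u v w, E₁.Adj u v → w ∈ S₂ → pos w ∈ segment ℝ (pos u) (pos v) →
      w = u ∨ w = v := by
    intro u v w huv hw hz
    obtain ⟨y, hy1, hy2, hy⟩ := hX _ (h₁.segment_subset u v huv hz) (h₂.pos_mem w hw)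
    obtain rfl := h₂.injOn hy2 hw hy
    exact h₁.vertex u v y huv hy1 hz
  have v21 : ∀ u v w, E₂.Adj u v → w ∈ S₁ → pos w ∈ segment ℝ (pos u) (pos v) →
      w = u ∨ w = v := by
    intro u v w huv hw hz
    obtain ⟨y, hy1, hy2, hy⟩ := hX _ (h₁.pos_mem w hw) (h₂.segment_subset u v huv hz)
    obtain rfl := h₁.injOn hy1 hw hy
    exact h₂.vertex u v y huv hy2 hz
  have i12 : ∀ u v u' v' z, E₁.Adj u v → E₂.Adj u' v' →
      z ∈ segment ℝ (pos u) (pos v) → z ∈ segment ℝ (pos u') (pos v') →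
      ∃ w, pos w = z ∧ (w = u ∨ w = v) ∧ (w = u' ∨ w = v') := by
    intro u v u' v' z huv huv' hz hz'
    obtain ⟨y, hy1, hy2, rfl⟩ := hX z (h₁.segment_subset u v huv hz)
      (h₂.segment_subset u' v' huv' hz')
    exact ⟨y, rfl, h₁.vertex u v y huv hy1 hz, h₂.vertex u' v' y huv' hy2 hz'⟩
  refine ⟨?_, ?_, ?_, ?_, ?_, ?_, ?_⟩
  · have key : ∀ x ∈ S₁, ∀ y ∈ S₂, pos x = pos y → x = y := by
      intro x hx y hy hxy
      obtain ⟨w, hw1, hw2, hw⟩ := hX _ (h₁.pos_mem x hx) (hxy ▸ h₂.pos_mem y hy)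
      rw [← h₁.injOn hw1 hx hw, h₂.injOn hw2 hy (hw.trans hxy)]
    rintro x (hx | hx) y (hy | hy) hxy
    · exact h₁.injOn hx hy hxy
    · exact key x hx y hy hxy
    · exact (key y hy x hx hxy.symm).symm
    · exact h₂.injOn hx hy hxy
  · rintro u v (h | h)
    · exact Or.inl (h₁.mem_left u v h)
    · exact Or.inr (h₂.mem_left u v h)
  · rintro u v w (h | h) (hw | hw)
    · exact h₁.vertex u v w h hw
    · exact v12 u v w h hw
    · exact v21 u v w h hw
    · exact h₂.vertex u v w h hw
  · rintro u v u' v' z (h | h) (h' | h') hne hz hz'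
    · exact h₁.inter u v u' v' z h h' hne hz hz'
    · exact i12 u v u' v' z h h' hz hz'
    · obtain ⟨w, hw, hw1, hw2⟩ := i12 u' v' u v z h' h hz' hz
      exact ⟨w, hw, hw2, hw1⟩
    · exact h₂.inter u v u' v' z h h' hne hz hz'
  · rintro u v (h | h)
    · exact h₁.unit u v h
    · exact h₂.unit u v h
  · rintro v (h | h)
    · exact Or.inl (h₁.pos_mem v h)
    · exact Or.inr (h₂.pos_mem v h)
  · rintro u v (h | h)
    · exact (h₁.segment_subset u v h).trans Set.subset_union_left
    · exact (h₂.segment_subset u v h).trans Set.subset_union_right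

lemma single_edge {p q : ι} {O a : Plane} (hpq : p ≠ q) (ha : ‖a‖ = 1) (hp : pos p = O)
    (hq : pos q = O + a) :
    IsUnitDrawing {p, q} (SimpleGraph.edge p q) pos (segment ℝ O (O + a)) := by
  have hne : O ≠ O + a := by
    intro h
    have : a = 0 := by simpa using h
    simp [this] at ha
  have hadj : ∀ {u v}, (SimpleGraph.edge p q).Adj u v → (u = p ∧ v = q) ∨ (u = q ∧ v = p) := by
    intro u v h
    rw [SimpleGraph.edge_adj] at h
    exact h.1
  refine ⟨?_, ?_, ?_, ?_, ?_, ?_, ?_⟩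
  · rintro x (rfl | rfl) y (rfl | rfl) h
    · rfl
    · rw [hp, hq] at h
      exact absurd h hne
    · rw [hp, hq] at h
      exact absurd h.symm hne
    · rfl
  · intro u v h
    rcases hadj h with ⟨rfl, rfl⟩ | ⟨rfl, rfl⟩ <;> simp
  · rintro u v w h (rfl | rfl) - <;> rcases hadj h with ⟨rfl, rfl⟩ | ⟨rfl, rfl⟩ <;> simp
  · intro u v u' v' z h h' hne'
    refine absurd ?_ hne'
    rcases hadj h with ⟨rfl, rfl⟩ | ⟨rfl, rfl⟩ <;> rcases hadj h' with ⟨rfl, rfl⟩ | ⟨rfl, rfl⟩ <;>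
      simp
  · intro u v h
    rcases hadj h with ⟨rfl, rfl⟩ | ⟨rfl, rfl⟩ <;> simp [hp, hq, ha]
  · rintro v (rfl | rfl)
    · rw [hp]
      exact left_mem_segment ℝ _ _
    · rw [hq]
      exact right_mem_segment ℝ _ _
  · intro u v h
    rcases hadj h with ⟨rfl, rfl⟩ | ⟨rfl, rfl⟩
    · rw [hp, hq]
    · rw [hp, hq, segment_symm]

end IsUnitDrawing

/-- The segment from `O` to `O + a` together with its Minkowski sum with the open cone spanned by
`m` and `r`. -/
def sector (O a m r : Plane) : Set Plane :=
  {z | ∃ l x y : ℝ, 0 ≤ l ∧ l ≤ 1 ∧ (x = 0 ∧ y = 0 ∨ 0 < x ∧ 0 < y) ∧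
    z = O + (l • a + x • m + y • r)}

lemma mem_segment_add {O a z : Plane} :
    z ∈ segment ℝ O (O + a) ↔ ∃ l : ℝ, 0 ≤ l ∧ l ≤ 1 ∧ z = O + l • a := by
  rw [segment_eq_image']
  constructor
  · rintro ⟨l, hl, rfl⟩
    exact ⟨l, hl.1, hl.2, by simp⟩
  · rintro ⟨l, h0, h1, rfl⟩
    exact ⟨l, ⟨h0, h1⟩, by simp⟩

/-- For every unit segment and every cone that starts on one side of its direction, the subgraph of
`K` on `S` together with the edge `pq` has a planar unit drawing in the sector of the segment, with
`pq` drawn as the segment. -/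
def IsSectorDrawable {ι : Type*} (K : SimpleGraph ι) (S : Set ι) (p q : ι) : Prop :=
  ∀ (O a m r : Plane) (σ : ℝ), ‖a‖ = 1 → 0 ≤ σ * det2 a m → 0 < σ * det2 m r →
    0 < σ * det2 a r → ∃ (pos : ι → Plane) (E : SimpleGraph ι), pos p = O ∧ pos q = O + a ∧
      E.Adj p q ∧ (∀ u ∈ S, ∀ v ∈ S, K.Adj u v → E.Adj u v) ∧
      IsUnitDrawing S E pos (sector O a m r)

lemma isSectorDrawable_pair {ι : Type*} (K : SimpleGraph ι) {p q : ι} (hpq : p ≠ q) :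
    IsSectorDrawable K {p, q} p q := by
  classical
  intro O a m r σ ha _ _ _
  have hq : (if q = p then O else O + a) = O + a := if_neg hpq.symm
  refine ⟨fun y => if y = p then O else O + a, SimpleGraph.edge p q, by simp, hq, ?_, ?_,
    (IsUnitDrawing.single_edge hpq ha (by simp) hq).mono ?_⟩
  · simp [SimpleGraph.edge_adj, hpq]
  · rintro u (rfl | rfl) v (rfl | rfl) h
    · exact absurd rfl h.ne
    · simp [SimpleGraph.edge_adj, hpq]
    · simp [SimpleGraph.edge_adj, hpq, hpq.symm]
    · exact absurd rfl h.ne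
  · intro z hz
    obtain ⟨l, h0, h1, rfl⟩ := mem_segment_add.mp hz
    exact ⟨l, 0, 0, h0, h1, Or.inl ⟨rfl, rfl⟩, by simp⟩

/-- Attaching a thin rhombus to the segment from `O` to `O + a` leaves three new segments, whose
sectors lie in the sector of the old segment and meet only in common ends. -/
lemma sector_split {O a m r d n : Plane} {σ κ : ℝ} (hκ : 0 < κ) (h1 : 0 ≤ σ * det2 a m)
    (h2 : 0 < σ * det2 m r) (h3 : 0 < σ * det2 a r) (hd : d = κ • (m + r)) (hn : n = m + d) :
    (0 < σ * det2 d r ∧ 0 < σ * det2 a n ∧ 0 < σ * det2 n d ∧ 0 < σ * det2 a d ∧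
      0 < -σ * det2 d n ∧ 0 < -σ * det2 n m ∧ 0 < -σ * det2 d m) ∧
    (segment ℝ O (O + a) ⊆ sector O a m r ∧ sector O d d r ⊆ sector O a m r ∧
      sector (O + d) a n d ⊆ sector O a m r ∧ sector (O + a) d n m ⊆ sector O a m r) ∧
    (∀ z ∈ segment ℝ O (O + a), z ∈ sector O d d r → z = O) ∧
    (∀ z ∈ segment ℝ O (O + a), z ∉ sector (O + d) a n d) ∧
    (∀ z ∈ segment ℝ O (O + a), z ∈ sector (O + a) d n m → z = O + a) ∧
    (∀ z ∈ sector O d d r, z ∈ sector (O + d) a n d → z = O + d) ∧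
    (∀ z ∈ sector O d d r, z ∉ sector (O + a) d n m) ∧
    (∀ z ∈ sector (O + d) a n d, z ∈ sector (O + a) d n m → z = O + d + a) := by
  -- In the orientation given by `σ` the angular order is `m`, `n`, `d`, `r`, so the open cones
  -- between neighbours are disjoint and lie in the cone of `m` and `r`. Each intersection claim is
  -- settled by the determinant with `a`, `d` or `n`, a linear functional separating the two sets.
  set A := σ * det2 a m with hA
  set B := σ * det2 m r with hB
  set C := σ * det2 a r with hC
  have e_dr : σ * det2 d r = κ * B := by rw [hd, hB]; simp [det2]; ring
  have e_ad : σ * det2 a d = κ * (A + C) := by rw [hd, hA, hC]; simp [det2]; ring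
  have e_md : σ * det2 m d = κ * B := by rw [hd, hB]; simp [det2]; ring
  have e_an : σ * det2 a n = A + κ * (A + C) := by
    rw [← e_ad, hn, hA]; simp [det2]; ring
  have e_nd : σ * det2 n d = κ * B := by rw [← e_md, hn]; simp only [det2, PiLp.add_apply]; ring
  have e_nm : -σ * det2 n m = κ * B := by rw [← e_md, hn]; simp only [det2, PiLp.add_apply]; ring
  have pB : 0 < κ * B := mul_pos hκ h2
  have pC : 0 < κ * (A + C) := mul_pos hκ (by linarith)
  have e_dn : -σ * det2 d n = κ * B := by rw [det2_comm d n, ← e_nd]; ring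
  have e_dm : -σ * det2 d m = κ * B := by rw [det2_comm d m, ← e_md]; ring
  have comb : ∀ (e x y z : Plane) (l s t : ℝ), σ * det2 e (l • x + s • y + t • z) =
      l * (σ * det2 e x) + s * (σ * det2 e y) + t * (σ * det2 e z) := by
    intro e x y z l s t
    rw [det2_comb]; ring
  have e_da : σ * det2 d a = - (κ * (A + C)) := by rw [det2_comm d a, ← e_ad]; ring
  have e_dn' : σ * det2 d n = - (κ * B) := by rw [← e_dn]; ring
  have e_dm' : σ * det2 d m = - (κ * B) := by rw [← e_dm]; ring
  have e_nm' : σ * det2 n m = - (κ * B) := by rw [← e_nm]; ring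
  have e_na : σ * det2 n a = - (A + κ * (A + C)) := by rw [det2_comm n a, ← e_an]; ring
  have s_a : σ * det2 a a = 0 := by rw [det2_self, mul_zero]
  have s_d : σ * det2 d d = 0 := by rw [det2_self, mul_zero]
  have s_n : σ * det2 n n = 0 := by rw [det2_self, mul_zero]
  refine ⟨⟨by rw [e_dr]; exact pB, by rw [e_an]; linarith, by rw [e_nd]; exact pB,
    by rw [e_ad]; exact pC, by rw [e_dn]; exact pB, by rw [e_nm]; exact pB,
    by rw [e_dm]; exact pB⟩, ⟨?_, ?_, ?_, ?_⟩, ?_, ?_, ?_, ?_, ?_, ?_⟩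
  · intro z hz
    obtain ⟨l, h0, h1, rfl⟩ := mem_segment_add.mp hz
    exact ⟨l, 0, 0, h0, h1, Or.inl ⟨rfl, rfl⟩, by simp⟩
  · rintro z ⟨l, x, y, hl0, hl1, hxy, rfl⟩
    refine ⟨0, κ * (l + x), κ * (l + x) + y, le_rfl, zero_le_one, ?_, ?_⟩
    · rcases hxy with ⟨rfl, rfl⟩ | ⟨hx, hy⟩
      · rcases hl0.eq_or_lt with rfl | hl
        · left; simp
        · right; constructor <;> simp [hκ, hl]
      · right
        have : 0 < κ * (l + x) := mul_pos hκ (by linarith)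
        exact ⟨this, by linarith⟩
    · rw [hd]; module
  · rintro z ⟨l, x, y, hl0, hl1, hxy, rfl⟩
    have hx : 0 ≤ x := by rcases hxy with ⟨rfl, rfl⟩ | ⟨hx, hy⟩ <;> linarith
    have hy : 0 ≤ y := by rcases hxy with ⟨rfl, rfl⟩ | ⟨hx, hy⟩ <;> linarith
    have : 0 < κ * (1 + x + y) := mul_pos hκ (by linarith)
    refine ⟨l, x + κ * (1 + x + y), κ * (1 + x + y), hl0, hl1, Or.inr ⟨by linarith, this⟩, ?_⟩
    rw [hn, hd]; module
  · rintro z ⟨l, x, y, hl0, hl1, hxy, rfl⟩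
    refine ⟨1, κ * (l + x) + x + y, κ * (l + x), zero_le_one, le_rfl, ?_, ?_⟩
    · rcases hxy with ⟨rfl, rfl⟩ | ⟨hx, hy⟩
      · rcases hl0.eq_or_lt with rfl | hl
        · left; simp
        · right; constructor <;> simp [hκ, hl]
      · right
        have : 0 < κ * (l + x) := mul_pos hκ (by linarith)
        exact ⟨by linarith, this⟩
    · rw [hn, hd]; module
  · intro z hz hz'
    obtain ⟨l, hl0, hl1, rfl⟩ := mem_segment_add.mp hz
    obtain ⟨k, x, y, hk0, hk1, hxy, heq⟩ := hz'
    have hy : 0 ≤ y := by rcases hxy with ⟨rfl, rfl⟩ | ⟨hx, hy⟩ <;> linarith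
    have hv := congrArg (fun v => σ * det2 d v) (add_left_cancel heq)
    rw [comb, show l • a = l • a + (0 : ℝ) • a + (0 : ℝ) • a by module, comb, e_da, s_d, e_dr] at hv
    have hl : l = 0 := by
      by_contra hne
      have := mul_pos (lt_of_le_of_ne hl0 (Ne.symm hne)) pC
      have := mul_nonneg hy pB.le
      linarith
    simp [hl]
  · intro z hz hz'
    obtain ⟨l, hl0, hl1, rfl⟩ := mem_segment_add.mp hz
    obtain ⟨k, x, y, hk0, hk1, hxy, heq⟩ := hz'
    have hx : 0 ≤ x := by rcases hxy with ⟨rfl, rfl⟩ | ⟨hx, hy⟩ <;> linarith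
    have hy : 0 ≤ y := by rcases hxy with ⟨rfl, rfl⟩ | ⟨hx, hy⟩ <;> linarith
    have heq' : O + l • a = O + (k • a + x • n + (1 + y) • d) := by rw [heq]; module
    have hv := congrArg (fun v => σ * det2 a v) (add_left_cancel heq')
    rw [comb, show l • a = l • a + (0 : ℝ) • a + (0 : ℝ) • a by module, comb, s_a, e_an, e_ad] at hv
    have := mul_nonneg hx (show 0 ≤ A + κ * (A + C) by linarith)
    have := mul_pos (show 0 < 1 + y by linarith) pC
    linarith
  · intro z hz hz'
    obtain ⟨l, hl0, hl1, rfl⟩ := mem_segment_add.mp hz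
    obtain ⟨k, x, y, hk0, hk1, hxy, heq⟩ := hz'
    have hx : 0 ≤ x := by rcases hxy with ⟨rfl, rfl⟩ | ⟨hx, hy⟩ <;> linarith
    have hy : 0 ≤ y := by rcases hxy with ⟨rfl, rfl⟩ | ⟨hx, hy⟩ <;> linarith
    have heq' : O + (l - 1) • a = O + (k • d + x • n + y • m) := by
      rw [sub_smul, one_smul, ← add_sub_assoc, heq]; module
    have hv := congrArg (fun v => σ * det2 a v) (add_left_cancel heq')
    rw [comb, show (l - 1) • a = (l - 1) • a + (0 : ℝ) • a + (0 : ℝ) • a by module, comb, s_a,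
      e_an, e_ad, ← hA] at hv
    have hyA := mul_nonneg hy h1
    have hk : k = 0 := by
      by_contra hne
      have := mul_pos (lt_of_le_of_ne hk0 (Ne.symm hne)) pC
      have := mul_nonneg hx (show 0 ≤ A + κ * (A + C) by linarith)
      linarith
    rcases hxy with ⟨rfl, rfl⟩ | ⟨hx', -⟩
    · rw [heq, hk]; module
    · have := mul_pos hx' (show 0 < A + κ * (A + C) by linarith)
      have := mul_nonneg hk0 pC.le
      linarith
  · rintro z ⟨l, s, t, hl0, hl1, hst, rfl⟩ ⟨k, x, y, hk0, hk1, hxy, heq⟩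
    have hx : 0 ≤ x := by rcases hxy with ⟨rfl, rfl⟩ | ⟨hx, hy⟩ <;> linarith
    have ht : 0 ≤ t := by rcases hst with ⟨rfl, rfl⟩ | ⟨hx, hy⟩ <;> linarith
    have heq' : O + (l • d + s • d + t • r) = O + (k • a + x • n + (1 + y) • d) := by
      rw [heq]; module
    have hv := congrArg (fun v => σ * det2 d v) (add_left_cancel heq')
    rw [comb, comb, s_d, e_da, e_dn', e_dr] at hv
    have htB := mul_nonneg ht pB.le
    have hkC := mul_nonneg hk0 pC.le
    have hxB := mul_nonneg hx pB.le
    have hk : k = 0 := by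
      by_contra hne
      have := mul_pos (lt_of_le_of_ne hk0 (Ne.symm hne)) pC
      linarith
    rcases hxy with ⟨rfl, rfl⟩ | ⟨hx', -⟩
    · rw [heq, hk]; module
    · have := mul_pos hx' pB
      linarith
  · rintro z ⟨l, s, t, hl0, hl1, hst, rfl⟩ ⟨k, x, y, hk0, hk1, hxy, heq⟩
    have hx : 0 ≤ x := by rcases hxy with ⟨rfl, rfl⟩ | ⟨hx, hy⟩ <;> linarith
    have hy : 0 ≤ y := by rcases hxy with ⟨rfl, rfl⟩ | ⟨hx, hy⟩ <;> linarith
    have ht : 0 ≤ t := by rcases hst with ⟨rfl, rfl⟩ | ⟨hx, hy⟩ <;> linarith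
    have heq' : O + ((l + s - k) • d + t • r + (0 : ℝ) • r) =
        O + ((1 : ℝ) • a + x • n + y • m) := by
      rw [show O + ((l + s - k) • d + t • r + (0 : ℝ) • r) =
        (O + (l • d + s • d + t • r)) - k • d by module, heq]; module
    have hv := congrArg (fun v => σ * det2 d v) (add_left_cancel heq')
    rw [comb, comb, s_d, e_da, e_dn', e_dr, e_dm'] at hv
    have := mul_nonneg ht pB.le
    have := mul_nonneg hx pB.le
    have := mul_nonneg hy pB.le
    linarith
  · rintro z ⟨l, s, t, hl0, hl1, hst, rfl⟩ ⟨k, x, y, hk0, hk1, hxy, heq⟩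
    have hy : 0 ≤ y := by rcases hxy with ⟨rfl, rfl⟩ | ⟨hx, hy⟩ <;> linarith
    have ht : 0 ≤ t := by rcases hst with ⟨rfl, rfl⟩ | ⟨hx, hy⟩ <;> linarith
    have heq' : O + ((l - 1) • a + s • n + t • d) = O + ((k - 1) • d + x • n + y • m) := by
      rw [show O + ((l - 1) • a + s • n + t • d) =
        (O + d + (l • a + s • n + t • d)) - a - d by module, heq]; module
    have hv := congrArg (fun v => σ * det2 n v) (add_left_cancel heq')
    rw [comb, comb, s_n, e_na, e_nd, e_nm'] at hv
    have q1 := mul_nonneg (show 0 ≤ 1 - l by linarith) (show 0 ≤ A + κ * (A + C) by linarith)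
    have q2 := mul_nonneg ht pB.le
    have q3 := mul_nonneg (show 0 ≤ 1 - k by linarith) pB.le
    have q4 := mul_nonneg hy pB.le
    have hl : l = 1 := by
      by_contra hne
      have := mul_pos (show 0 < 1 - l by
        have := lt_of_le_of_ne hl1 hne
        linarith) (show 0 < A + κ * (A + C) by linarith)
      linarith
    rcases hst with ⟨rfl, rfl⟩ | ⟨-, ht'⟩
    · rw [hl]; module
    · have := mul_pos ht' pB
      linarith

/-- Drawings in the three sectors of a rhombus can be glued. -/
lemma IsSectorDrawable.glue {ι : Type*} {K : SimpleGraph ι} {S S₁ S₂ S₃ : Set ι} {p x w q : ι}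
    (hS : S = S₁ ∪ S₂ ∪ S₃) (h₁ : IsSectorDrawable K S₁ p x) (h₂ : IsSectorDrawable K S₂ x w)
    (h₃ : IsSectorDrawable K S₃ q w) (hp : p ∈ S₁) (hx₁ : x ∈ S₁) (hx₂ : x ∈ S₂) (hw₂ : w ∈ S₂)
    (hw₃ : w ∈ S₃) (hq : q ∈ S₃) (h₁₂ : ∀ y ∈ S₁, y ∈ S₂ → y = x)
    (h₂₃ : ∀ y ∈ S₂, y ∈ S₃ → y = w) (h₁₃ : ∀ y ∈ S₁, y ∉ S₃)
    (hK : ∀ u ∈ S, ∀ v ∈ S, K.Adj u v → s(u, v) = s(p, q) ∨ (u ∈ S₁ ∧ v ∈ S₁) ∨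
      (u ∈ S₂ ∧ v ∈ S₂) ∨ (u ∈ S₃ ∧ v ∈ S₃)) :
    IsSectorDrawable K S p q := by
  classical
  intro O a m r σ ha h1 h2 h3
  have hpq : p ≠ q := fun h => h₁₃ p hp (h ▸ hq)
  have hmr : m + r ≠ 0 := by
    intro h
    have : det2 m r = 0 := by
      rw [eq_neg_of_add_eq_zero_right h]
      simp [det2]
      ring
    rw [this, mul_zero] at h2
    exact lt_irrefl _ h2
  have hnorm : 0 < ‖m + r‖ := norm_pos_iff.mpr hmr
  set κ := ‖m + r‖⁻¹ with hκ
  have hκ0 : 0 < κ := inv_pos.mpr hnorm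
  -- The unit vector `d` points into the open cone. The rhombus has corners `O`, `O + d`, `O + d +
  -- a`, `O + a` for `p`, `x`, `w`, `q`.
  obtain ⟨d, hd⟩ : ∃ d, d = κ • (m + r) := ⟨_, rfl⟩
  obtain ⟨n, hn⟩ : ∃ n, n = m + d := ⟨_, rfl⟩
  have hdn : ‖d‖ = 1 := by
    rw [hd, norm_smul, Real.norm_of_nonneg hκ0.le, hκ, inv_mul_cancel₀ hnorm.ne']
  obtain ⟨⟨c1, c2, c3, c4, c5, c6, c7⟩, ⟨s0, s1, s2, s3⟩, i01, i02, i03, i12, i13, i23⟩ :=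
    sector_split (O := O) hκ0 h1 h2 h3 hd hn
  -- The cone starts along the side itself; this is the equality case allowed by the weak inequality
  -- in `IsSectorDrawable`.
  obtain ⟨pos₁, E₁, hp1, hx1, -, hE1, D1⟩ := h₁ O d d r σ hdn (by simp [det2_self]) c1 c1
  obtain ⟨pos₂, E₂, hx2, hw2, -, hE2, D2⟩ := h₂ (O + d) a n d σ ha c2.le c3 c4
  -- The opposite side is drawn from `q` to `w` with its cone on the other side of `d`, hence `-σ`.
  obtain ⟨pos₃, E₃, hq3, hw3, -, hE3, D3⟩ := h₃ (O + a) d n m (-σ) hdn c5.le c6 c7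
  set pos : ι → Plane := fun y => if y ∈ S₁ then pos₁ y else if y ∈ S₂ then pos₂ y else pos₃ y
    with hpos
  have e1 : ∀ y ∈ S₁, pos y = pos₁ y := fun y hy => if_pos hy
  have e2 : ∀ y ∈ S₂, pos y = pos₂ y := by
    intro y hy
    by_cases h : y ∈ S₁
    · obtain rfl := h₁₂ y h hy
      rw [e1 _ h, hx1, hx2]
    · simp [hpos, h, hy]
  have e3 : ∀ y ∈ S₃, pos y = pos₃ y := by
    intro y hy
    by_cases h : y ∈ S₂
    · obtain rfl := h₂₃ y h hy
      rw [e2 _ h, hw2, hw3, add_right_comm]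
    · have h' : y ∉ S₁ := fun h' => h₁₃ y h' hy
      simp [hpos, h, h']
  have hposp : pos p = O := (e1 p hp).trans hp1
  have hposq : pos q = O + a := (e3 q hq).trans hq3
  have hposx : pos x = O + d := (e1 x hx₁).trans hx1
  have hposw : pos w = O + d + a := (e2 w hw₂).trans hw2
  have D := (((IsUnitDrawing.single_edge hpq ha hposp hposq).union (D1.congr e1) (by
      intro z h h'
      exact ⟨p, by simp, hp, by rw [hposp, i01 z h h']⟩)).union (D2.congr e2) (by
      rintro z (h | h) h'
      · exact absurd h' (i02 z h)
      · exact ⟨x, Or.inr hx₁, hx₂, by rw [hposx, i12 z h h']⟩)).union (D3.congr e3) (by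
      rintro z ((h | h) | h) h'
      · exact ⟨q, by simp, hq, by rw [hposq, i03 z h h']⟩
      · exact absurd h' (i13 z h)
      · exact ⟨w, Or.inr hw₂, hw₃, by rw [hposw, i23 z h h']⟩)
  have hSeq : {p, q} ∪ S₁ ∪ S₂ ∪ S₃ = S := by
    rw [hS]
    ext y
    simp only [Set.mem_union, Set.mem_insert_iff, Set.mem_singleton_iff]
    constructor
    · rintro ((((rfl | rfl) | h) | h) | h) <;> tauto
    · tauto
  rw [hSeq] at D
  refine ⟨pos, _, hposp, hposq, ?_, ?_, D.mono ?_⟩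
  · exact Or.inl (Or.inl (Or.inl (by simp [SimpleGraph.edge_adj, hpq])))
  · intro u hu v hv huv
    rcases hK u hu v hv huv with h | ⟨hu', hv'⟩ | ⟨hu', hv'⟩ | ⟨hu', hv'⟩
    · refine Or.inl (Or.inl (Or.inl ?_))
      rw [SimpleGraph.edge_adj]
      refine ⟨?_, huv.ne⟩
      simpa using h
    · exact Or.inl (Or.inl (Or.inr (hE1 u hu' v hv' huv)))
    · exact Or.inl (Or.inr (hE2 u hu' v hv' huv))
    · exact Or.inr (hE3 u hu' v hv' huv)
  · exact Set.union_subset (Set.union_subset (Set.union_subset s0 s1) s2) s3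

/-- Splitting an interval along a quadrilateral. -/
lemma exists_quadrilateral {K : SimpleGraph ℕ} (hodd : ∀ x y, K.Adj x y → Odd (x + y))
    (hcross : ∀ x y z w, K.Adj x y → K.Adj z w → ¬ (x < z ∧ z < y ∧ y < w)) {i j : ℕ}
    (hij : Odd (i + j)) (hlt : i + 1 < j) :
    ∃ x w, i < x ∧ x < w ∧ w < j ∧ Odd (i + x) ∧ Odd (x + w) ∧ Odd (w + j) ∧
      ∀ u v, i ≤ u → u < v → v ≤ j → K.Adj u v →
        (u = i ∧ v = j) ∨ v ≤ x ∨ (x ≤ u ∧ v ≤ w) ∨ w ≤ u := by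
  classical
  -- `x` is the farthest neighbour of `i` inside the interval, or `i + 1` if there is none.
  have hx : ∃ x, i < x ∧ x < j ∧ Odd (i + x) ∧ (∀ v, i < v → v < j → K.Adj i v → v ≤ x) ∧
      ∀ u v, i < u → u < x → x < v → v ≤ j → ¬ K.Adj u v := by
    by_cases hne : ∃ x, i < x ∧ x < j ∧ K.Adj i x
    · set x := Nat.findGreatest (fun x => i < x ∧ x < j ∧ K.Adj i x) j with hxdef
      obtain ⟨x0, hx0⟩ := hne
      obtain ⟨h1, h2, h3⟩ : i < x ∧ x < j ∧ K.Adj i x :=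
        Nat.findGreatest_spec (P := fun x => i < x ∧ x < j ∧ K.Adj i x) hx0.2.1.le hx0
      refine ⟨x, h1, h2, hodd _ _ h3, fun v hv hvj hadj => ?_, fun u v hu hux hxv _ hadj => ?_⟩
      · exact Nat.le_findGreatest (P := fun x => i < x ∧ x < j ∧ K.Adj i x) hvj.le ⟨hv, hvj, hadj⟩
      · exact hcross _ _ _ _ h3 hadj ⟨hu, hux, hxv⟩
    · refine ⟨i + 1, by omega, hlt, ⟨i, by ring⟩, fun v hv hvj hadj => ?_, fun u v hu hux => ?_⟩
      · exact absurd ⟨v, hv, hvj, hadj⟩ hne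
      · omega
  obtain ⟨x, hix, hxj, hxo, hxmax, hxcross⟩ := hx
  rw [Nat.odd_iff] at hij hxo
  -- `w` is the first neighbour of `j` after `x`, or `j - 1` by default. Since `x` and `j` have
  -- equal parity, `j - 1` still exceeds `x`.
  have hw : ∃ w, x < w ∧ w < j ∧ Odd (w + j) ∧ (∀ u, x < u → u < j → K.Adj u j → w ≤ u) ∧
      ∀ u v, u < w → w < v → v < j → x ≤ u → ¬ K.Adj u v := by
    by_cases hne : ∃ w, x < w ∧ w < j ∧ K.Adj w j
    · obtain ⟨h1, h2, h3⟩ := Nat.find_spec hne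
      refine ⟨Nat.find hne, h1, h2, hodd _ _ h3, fun u hu huj hadj => ?_,
        fun u v hu hv hvj _ hadj => ?_⟩
      · exact Nat.find_min' hne ⟨hu, huj, hadj⟩
      · exact hcross _ _ _ _ hadj h3 ⟨hu, hv, hvj⟩
    · refine ⟨j - 1, by omega, by omega, by rw [Nat.odd_iff]; omega, fun u hu huj hadj => ?_,
        fun u v hu hv hvj => by omega⟩
      exact absurd ⟨u, hu, huj, hadj⟩ hne
  obtain ⟨w, hxw, hwj, hwo, hwmin, hwcross⟩ := hw
  rw [Nat.odd_iff] at hwo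
  refine ⟨x, w, hix, hxw, hwj, by rwa [Nat.odd_iff], by rw [Nat.odd_iff]; omega,
    by rwa [Nat.odd_iff], ?_⟩
  intro u v hu huv hv hadj
  by_contra hcon
  push Not at hcon
  obtain ⟨hne, hvx, hmid, huw⟩ := hcon
  have hpar := hodd _ _ hadj
  rw [Nat.odd_iff] at hpar
  rcases hu.eq_or_lt with rfl | hu
  · have hvj : v ≠ j := hne rfl
    have := hxmax v huv (by omega) hadj
    omega
  rcases lt_or_ge u x with hux | hux
  · exact hxcross u v hu hux hvx hv hadj
  have hvw := hmid hux
  rcases hv.eq_or_lt with rfl | hvj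
  · rcases hux.eq_or_lt with rfl | hux
    · omega
    · have := hwmin u hux (by omega) hadj
      omega
  · exact hwcross u v huw hvw hvj hux hadj

/-- Strong induction on the length of the interval, gluing along the quadrilateral. Both directions
of the base edge are carried along because gluing uses one of the sides in the reverse direction. -/
lemma isSectorDrawable_Icc {K : SimpleGraph ℕ} (hodd : ∀ x y, K.Adj x y → Odd (x + y))
    (hcross : ∀ x y z w, K.Adj x y → K.Adj z w → ¬ (x < z ∧ z < y ∧ y < w)) (n : ℕ) :
    ∀ i j, j - i = n → i < j → Odd (i + j) →
      IsSectorDrawable K (Set.Icc i j) i j ∧ IsSectorDrawable K (Set.Icc i j) j i := by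
  induction n using Nat.strong_induction_on with
  | _ n ih =>
    intro i j hn hlt hij
    rcases (show i + 1 ≤ j from hlt).eq_or_lt with rfl | hlt'
    · have : Set.Icc i (i + 1) = {i, i + 1} := by
        ext y
        simp only [Set.mem_Icc, Set.mem_insert_iff, Set.mem_singleton_iff]
        omega
      rw [this]
      refine ⟨isSectorDrawable_pair K (by omega), ?_⟩
      rw [Set.pair_comm]
      exact isSectorDrawable_pair K (by omega)
    · obtain ⟨x, w, hix, hxw, hwj, o1, o2, o3, hedge⟩ := exists_quadrilateral hodd hcross hij hlt'
      obtain ⟨a1, a2⟩ := ih (x - i) (by omega) i x rfl hix o1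
      obtain ⟨b1, b2⟩ := ih (w - x) (by omega) x w rfl hxw o2
      obtain ⟨c1, c2⟩ := ih (j - w) (by omega) w j rfl hwj o3
      have hK : ∀ u ∈ Set.Icc i j, ∀ v ∈ Set.Icc i j, K.Adj u v → s(u, v) = s(i, j) ∨
          (u ∈ Set.Icc i x ∧ v ∈ Set.Icc i x) ∨ (u ∈ Set.Icc x w ∧ v ∈ Set.Icc x w) ∨
          (u ∈ Set.Icc w j ∧ v ∈ Set.Icc w j) := by
        intro u hu v hv huv
        simp only [Set.mem_Icc, Sym2.eq_iff] at hu hv ⊢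
        rcases lt_or_gt_of_ne huv.ne with h | h
        · have := hedge u v hu.1 h hv.2 huv
          omega
        · have := hedge v u hv.1 h hu.2 huv.symm
          omega
      constructor
      · refine IsSectorDrawable.glue (S₁ := Set.Icc i x) (S₂ := Set.Icc x w) (S₃ := Set.Icc w j)
          ?_ a1 b1 c2 ?_ ?_ ?_ ?_ ?_ ?_ ?_ ?_ ?_ hK
        · ext y
          simp only [Set.mem_Icc, Set.mem_union]
          omega
        all_goals simp only [Set.mem_Icc]
        all_goals omega
      · refine IsSectorDrawable.glue (S₁ := Set.Icc w j) (S₂ := Set.Icc x w) (S₃ := Set.Icc i x)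
          ?_ c2 b2 a1 ?_ ?_ ?_ ?_ ?_ ?_ ?_ ?_ ?_ ?_
        · ext y
          simp only [Set.mem_Icc, Set.mem_union]
          omega
        all_goals try simp only [Set.mem_Icc]
        all_goals try omega
        intro u hu v hv huv
        have := hK u hu v hv huv
        rw [Sym2.eq_swap (a := j)]
        simp only [Set.mem_Icc] at this
        tauto

/-- A unit drawing yields a planar straight-line drawing of every graph embedded in it. -/
lemma IsUnitDrawing.isPlanarStraightLineDrawing {V ι : Type*} {G : SimpleGraph V} {S : Set ι}
    {E : SimpleGraph ι} {pos : ι → Plane} {X : Set Plane} (h : IsUnitDrawing S E pos X) {g : V → ι}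
    (hg : Function.Injective g) (hS : ∀ v, g v ∈ S) (hE : ∀ u v, G.Adj u v → E.Adj (g u) (g v)) :
    IsPlanarStraightLineDrawing G (fun v => pos (g v)) where
  pos_injective u v huv := hg (h.injOn (hS u) (hS v) huv)
  isArc u v huv := by
    have hne : pos (g u) ≠ pos (g v) := fun he => huv.ne (hg (h.injOn (hS u) (hS v) he))
    refine ⟨⟨⟨fun t => AffineMap.lineMap (pos (g u)) (pos (g v)) (t : ℝ), ?_⟩, by simp, by simp⟩,
      ?_, ?_⟩
    · simp only [AffineMap.lineMap_apply_module]
      fun_prop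
    · intro s t hst
      exact Subtype.ext (AffineMap.lineMap_injective ℝ hne hst)
    · change _ = segment ℝ (pos (g u)) (pos (g v))
      rw [segment_eq_image_lineMap]
      ext z
      constructor
      · rintro ⟨t, rfl⟩
        exact ⟨t, t.2, rfl⟩
      · rintro ⟨t, ht, rfl⟩
        exact ⟨⟨t, ht⟩, rfl⟩
  vertex_mem e he w hw := by
    induction e using Sym2.ind with
    | _ u v =>
      rw [Sym2.mem_iff]
      exact (h.vertex (g u) (g v) (g w) (hE u v he) (hS w) hw).imp (fun h => hg h) fun h => hg h
  inter_subset e he f hf hef := by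
    induction e using Sym2.ind with
    | _ u v =>
    induction f using Sym2.ind with
    | _ u' v' =>
      rintro z ⟨hz, hz'⟩
      obtain ⟨w, rfl, hw, hw'⟩ := h.inter (g u) (g v) (g u') (g v') z (hE u v he) (hE u' v' hf)
        (fun heq => hef (Sym2.map.injective hg heq)) hz hz'
      obtain ⟨y, rfl⟩ : ∃ y, g y = w := by
        rcases hw with rfl | rfl
        exacts [⟨u, rfl⟩, ⟨v, rfl⟩]
      refine ⟨y, ⟨?_, ?_⟩, rfl⟩
      · exact Sym2.mem_iff.mpr (hw.imp (fun h => hg h) fun h => hg h)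
      · exact Sym2.mem_iff.mpr (hw'.imp (fun h => hg h) fun h => hg h)

/-- The vertices are embedded in `[0, 2N + 1]`, whose odd length the rhombus induction requires.
Auxiliary rhombus sides that are not edges of `G` are discarded at the end. -/
theorem exists_unit_drawing {V : Type*} [Finite V] {G : SimpleGraph V} (hbip : G.IsBipartite)
    (hG : IsOuterplanar G) :
    ∃ pos : V → Plane, IsPlanarStraightLineDrawing G pos ∧
      ∀ u v : V, G.Adj u v → dist (pos u) (pos v) = 1 := by
  obtain ⟨g, hg, hodd, hcross⟩ := hG.exists_noncrossing_nat hbip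
  obtain ⟨N, hN⟩ := (Set.finite_range g).bddAbove
  set K : SimpleGraph ℕ := G.map g
  have hK' : ∀ x y, K.Adj x y → ∃ u v, G.Adj u v ∧ g u = x ∧ g v = y := by
    intro x y h
    exact h.2
  have hdraw := (isSectorDrawable_Icc (K := K) (by
      intro x y h
      obtain ⟨u, v, huv, rfl, rfl⟩ := hK' x y h
      exact hodd u v huv) (by
      intro x y z w h h'
      obtain ⟨u, v, huv, rfl, rfl⟩ := hK' x y h
      obtain ⟨s, t, hst, rfl, rfl⟩ := hK' z w h'
      exact hcross u v s t huv hst) _ 0 (2 * N + 1) rfl (by omega) ⟨N, by ring⟩).1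
  obtain ⟨pos, E, -, -, -, hE, D⟩ := hdraw 0 (EuclideanSpace.single 0 1)
    (EuclideanSpace.single 0 1) (EuclideanSpace.single 1 1) 1 (by simp) (by simp [det2])
    (by simp [det2]) (by simp [det2])
  have hmem : ∀ v, g v ∈ Set.Icc 0 (2 * N + 1) := by
    intro v
    have : g v ≤ N := hN ⟨v, rfl⟩
    exact ⟨Nat.zero_le _, by omega⟩
  have hadj : ∀ u v, G.Adj u v → E.Adj (g u) (g v) := fun u v huv =>
    hE _ (hmem u) _ (hmem v)
      (SimpleGraph.map_adj_apply' huv fun h => huv.ne (hg h))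
  exact ⟨fun v => pos (g v), D.isPlanarStraightLineDrawing hg hmem hadj,
    fun u v huv => D.unit _ _ (hadj u v huv)⟩

end GraphDrawing

theorem theorem2 {V : Type*} [Finite V] (G : SimpleGraph V)
    (hbip : G.IsBipartite) (houter : GraphDrawing.IsOuterplanar G) :
    (∃ pos : V → GraphDrawing.Plane, GraphDrawing.IsPlanarStraightLineDrawing G pos ∧
      ∀ u v : V, G.Adj u v → dist (pos u) (pos v) = 1) ∧
    (G ≠ ⊥ → GraphDrawing.IsPlanarEdgeLengthRatio G 1) := by
  obtain ⟨pos, hpos, hunit⟩ := GraphDrawing.exists_unit_drawing hbip houter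
  refine ⟨⟨pos, hpos, hunit⟩, fun hne => ⟨⟨pos, hpos, 1, 1, ?_, ?_, by simp⟩, ?_⟩⟩
  · obtain ⟨u, v, huv⟩ := SimpleGraph.ne_bot_iff_exists_adj.mp hne
    refine ⟨⟨u, v, huv, (hunit u v huv).symm⟩, ?_⟩
    rintro l ⟨x, y, hxy, rfl⟩
    exact (hunit x y hxy).le
  · obtain ⟨u, v, huv⟩ := SimpleGraph.ne_bot_iff_exists_adj.mp hne
    refine ⟨⟨u, v, huv, (hunit u v huv).symm⟩, ?_⟩
    rintro l ⟨x, y, hxy, rfl⟩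
    exact (hunit x y hxy).ge
  -- No ratio is below 1: the shortest length is itself an edge length and is positive, as positions
  -- are distinct.
  · rintro r ⟨pos', hpos', longest, shortest, hl, hs, rfl⟩
    obtain ⟨u, v, huv, rfl⟩ := hs.1
    have h0 : 0 < dist (pos' u) (pos' v) :=
      dist_pos.mpr fun h => huv.ne (hpos'.pos_injective h)
    rw [one_le_div h0]
    exact hl.2 ⟨u, v, huv, rfl⟩
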